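/- Let $r\ge 1$ and let $m_1,\dots,m_r\ge 0$ be integers with $m_1+\dots+m_r=2g-2$. Let $\mathcal H(m_1,\dots,m_r)$ be the stratum of Abelian differentials on genus $g$ surfaces with numbered zeroes $P_1,\dots,P_r$ of orders $m_1,\dots,m_r$ (a zero of order $0$ being a marked point), and let $d=\dim_{\mathbb C}\mathcal H(m_1,\dots,m_r)=2g+r-1$. A square-tiled surface in this stratum is a connected surface with such a differential obtained by gluing finitely many unit squares along their sides by translations (left sides to right sides, bottom sides to top sides), with all the points $P_i$ at vertices of the squares; such surfaces are considered up to isomorphism preserving the tiling and the numbering of the zeroes. The absolute contribution of $1$-cylinder diagrams to the Masur–Veech volume $\operatorname{Vol}\mathcal H_1(m_1,\dots,m_r)$ is $$c_1(m_1,\dots,m_r)=2d\cdot\lim_{a\to+\infty}\frac{1}{a^{d}}\,\#\{S\ :\ \operatorname{Area}(S)\le a\},$$ where $S$ runs over the square-tiled surfaces in $\mathcal H(m_1,\dots,m_r)$ with exactly one maximal horizontal cylinder (that is, the complement of the union of the points $P_i$ and of the horizontal segments joining them is connected). **Theorem.** Put $n=(m_1+1)+\dots+(m_r+1)$. Then $n=d-1$,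 the limit above exists, and $$c_1(m_1,\dots,m_r)=\frac{2}{n!}\cdot\prod_k\frac{1}{(k+1)^{\mu_k}}\cdot\sum_{j=0}^{n-1}j!\,(n-1-j)!\,\chi_j(\nu)\cdot\zeta(n+1).$$ Here $\mu_k$ is the number of indices $i$ with $m_i=k$, $\nu\in\mathfrak S_n$ is any permutation which decomposes into cycles of lengths $m_1+1,\dots,m_r+1$ (fixed points counting as cycles of length $1$), and $\chi_j$ is the character of the exterior power $\wedge^j(\mathbf{St}_n)$ of the standard representation $\mathbf{St}_n=\mathbb C^n/\mathbb C$ of the symmetric group $\mathfrak S_n$. -/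

import Mathlib

open Filter Topology

/-! ### Square-tiled surfaces -/

/-- A (connected) square-tiled surface made of `N` unit squares, in the stratum of Abelian
differentials with numbered zeroes `P_0, …, P_{r-1}` of orders `m 0, …, m (r-1)`.

The squares are numbered by `Fin N`.  The right side of the square `x` is glued by a translation to
the left side of the square `right x`, and the top side of `x` to the bottom side of `up x`.
`zero x` is the number of the zero sitting at the upper right corner of the square `x`
(and `none` if that corner is not one of the points `P_i`).

Going once counterclockwise (by the angle `2π`) around the upper right corner of `x`, one
passes from `x` to `right x`, `up (right x)`, `right⁻¹ (up (right x))` and arrives at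
`up⁻¹ (right⁻¹ (up (right x)))`.  Hence the vertices of the tiling are the cycles (fixed points
included) of the permutation `up⁻¹ * right⁻¹ * up * right`, a vertex given by a cycle of length
`l` having cone angle `2π l`, that is, being a zero of order `l - 1`. -/
@[ext]
structure SquareTiledSurface {r : ℕ} (m : Fin r → ℕ) (N : ℕ) where
  /-- the square glued to the right side of a given square -/
  right : Equiv.Perm (Fin N)
  /-- the square glued to the top side of a given square -/
  up : Equiv.Perm (Fin N)
  /-- the number of the zero at the upper right corner of a given square, if there is one -/
  zero : Fin N → Option (Fin r)
  /-- the surface is connected -/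
  connected : ∀ x y : Fin N, ∃ σ ∈ Subgroup.closure {right, up}, σ x = y
  /-- the corners labelled by the same `P_i` are exactly the corners meeting at one vertex -/
  zero_eq_iff : ∀ (x y : Fin N) (i : Fin r), zero x = some i →
    (zero y = some i ↔ (up⁻¹ * right⁻¹ * up * right).SameCycle x y)
  /-- the cone angle at `P_i` is `2π (m i + 1)`; in particular `P_i` is present on the surface -/
  card_zero : ∀ i : Fin r, Nat.card {x : Fin N // zero x = some i} = m i + 1
  /-- every vertex other than the `P_i` is a regular point (has cone angle `2π`) -/
  regular : ∀ x : Fin N, zero x = none → (up⁻¹ * right⁻¹ * up * right) x = x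

namespace SquareTiledSurface

variable {r : ℕ} {m : Fin r → ℕ} {N : ℕ}

/-- Isomorphism of square-tiled surfaces with numbered zeroes: a bijection between the squares which
respects the gluings of the sides and the numbering of the zeroes. -/
def Iso (S T : SquareTiledSurface m N) : Prop :=
  ∃ e : Equiv.Perm (Fin N), ∀ x, e (S.right x) = T.right (e x) ∧ e (S.up x) = T.up (e x) ∧
    T.zero (e x) = S.zero x

theorem Iso.refl (S : SquareTiledSurface m N) : Iso S S :=
  ⟨1, fun _ => ⟨rfl, rfl, rfl⟩⟩

theorem Iso.symm {S T : SquareTiledSurface m N} (h : Iso S T) : Iso T S := by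
  obtain ⟨e, he⟩ := h
  refine ⟨e.symm, fun x => ?_⟩
  obtain ⟨h1, h2, h3⟩ := he (e.symm x)
  rw [Equiv.apply_symm_apply] at h1 h2 h3
  exact ⟨by rw [← h1, Equiv.symm_apply_apply], by rw [← h2, Equiv.symm_apply_apply], h3.symm⟩

theorem Iso.trans {S T U : SquareTiledSurface m N} (h : Iso S T) (h' : Iso T U) : Iso S U := by
  obtain ⟨e, he⟩ := h
  obtain ⟨f, hf⟩ := h'
  refine ⟨f * e, fun x => ?_⟩
  obtain ⟨h1, h2, h3⟩ := he x
  obtain ⟨k1, k2, k3⟩ := hf (e x)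
  simp only [Equiv.Perm.mul_apply]
  exact ⟨by rw [h1, k1], by rw [h2, k2], by rw [k3, h3]⟩

/-- Two square-tiled surfaces represent the same point of the stratum when they are isomorphic. -/
instance setoid (m : Fin r → ℕ) (N : ℕ) : Setoid (SquareTiledSurface m N) where
  r := Iso
  iseqv := ⟨Iso.refl, Iso.symm, Iso.trans⟩

/-- The horizontal circle bounding from above the row of squares containing `x` (the cycle of `x`
under `right`) contains no zero, so that it is a regular closed horizontal leaf. -/
def TopRegular (S : SquareTiledSurface m N) (x : Fin N) : Prop :=
  ∀ y, S.right.SameCycle x y → S.zero y = none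

/-- Elementary adjacency inside a maximal horizontal cylinder: `y` is the right neighbour of `x`, or
it is the top neighbour of `x` and the two rows are separated by a regular closed leaf. -/
def CylinderStep (S : SquareTiledSurface m N) (x y : Fin N) : Prop :=
  y = S.right x ∨ (y = S.up x ∧ S.TopRegular x)

/-- The set of maximal horizontal cylinders, i.e. of connected components of the complement of
the union of the zeroes and of the horizontal saddle connections.  Such a cylinder is
represented by the set of squares it is tiled with. -/
def Cylinders (S : SquareTiledSurface m N) : Type :=
  Quotient (Relation.EqvGen.setoid S.CylinderStep)

/-- The number of maximal horizontal cylinders. -/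
noncomputable def numCylinders (S : SquareTiledSurface m N) : ℕ :=
  Nat.card S.Cylinders

end SquareTiledSurface

/-- The number of (isomorphism classes of) square-tiled surfaces with numbered zeroes of
orders `m i`, tiled with exactly `N` unit squares, having exactly `k` maximal horizontal
cylinders. -/
noncomputable def numSquareTiled {r : ℕ} (m : Fin r → ℕ) (k N : ℕ) : ℕ :=
  Nat.card {q : Quotient (SquareTiledSurface.setoid m N) //
    ∃ S : SquareTiledSurface m N, ⟦S⟧ = q ∧ S.numCylinders = k}

/-- The complex dimension `2g + r - 1` of a stratum of Abelian differentials with `r` zeroes on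
surfaces of genus `g`. -/
def stratumDim (g r : ℕ) : ℕ := 2 * g + r - 1

/-- `c` is the (absolute) contribution of square-tiled surfaces with `k` maximal horizontal cylinders
to the Masur–Veech volume of the genus `g` stratum with numbered zeroes of orders `m i`:
the limit
`c = 2 d · lim_{a → +∞} a^{-d} · card {S with k cylinders | Area S ≤ a}` exists,
where `d` is the dimension of the stratum. -/
def IsCylinderContribution (g : ℕ) {r : ℕ} (m : Fin r → ℕ) (k : ℕ) (c : ℝ) : Prop :=
  Tendsto (fun a : ℝ => 2 * (stratumDim g r : ℝ) *
      ((1 / a ^ stratumDim g r) * ((∑ N ∈ Finset.Icc 1 ⌊a⌋₊, numSquareTiled m k N : ℕ) : ℝ)))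
    atTop (𝓝 c)

/-! ### Exterior powers of the standard representation of the symmetric group -/

/-- The permutation representation of the symmetric group on `ℂ^n`,
`(g • f) i = f (g⁻¹ i)`. -/
noncomputable def permRep (n : ℕ) : Representation ℂ (Equiv.Perm (Fin n)) (Fin n → ℂ) where
  toFun g := LinearMap.funLeft ℂ ℂ (g⁻¹ : Equiv.Perm (Fin n))
  map_one' := by ext; simp
  map_mul' g h := by ext; simp [LinearMap.funLeft_apply]

/-- The line of constant vectors in `ℂ^n`. -/
def constLine (n : ℕ) : Submodule ℂ (Fin n → ℂ) := Submodule.span ℂ {fun _ => 1}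

theorem constLine_le_comap (n : ℕ) (g : Equiv.Perm (Fin n)) :
    constLine n ≤ (constLine n).comap (permRep n g) := by
  rw [constLine, Submodule.span_le, Set.singleton_subset_iff]
  exact Submodule.subset_span rfl

/-- The standard representation `St_n = ℂ^n / ℂ` of the symmetric group. -/
noncomputable def standardRep (n : ℕ) :
    Representation ℂ (Equiv.Perm (Fin n)) ((Fin n → ℂ) ⧸ constLine n) :=
  (permRep n).quotient (constLine n) (constLine_le_comap n)

/-- The `j`-th exterior power of the standard representation. -/
noncomputable def extStandardRep (n j : ℕ) :
    Representation ℂ (Equiv.Perm (Fin n)) (⋀[ℂ]^j ((Fin n → ℂ) ⧸ constLine n)) where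
  toFun g := exteriorPower.map j (standardRep n g)
  map_one' := by rw [map_one]; exact exteriorPower.map_id
  map_mul' g h := by rw [map_mul]; exact exteriorPower.map_comp (standardRep n h) (standardRep n g)

/-- The character `χ_j` of the `j`-th exterior power of the standard representation. -/
noncomputable def extChar (n j : ℕ) (g : Equiv.Perm (Fin n)) : ℂ :=
  (extStandardRep n j).character g

/-- `μ_k`: the number of zeroes of order `k`. -/
def zeroMult {r : ℕ} (m : Fin r → ℕ) (k : ℕ) : ℕ := (Finset.univ.filter fun i => m i = k).card

/-! A one-cylinder surface with `N` squares is a rectangle of height `h` and width `w`, `h * w = N`,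
with vertical sides identified and top glued to bottom by a permutation `π` of `ZMod w`; the twist
is absorbed in `π`. Only the horizontal base point is arbitrary, so the surfaces are counted by
summing over `w ∣ N` the labelled gluings modulo rotation (`numSquareTiled_one_eq`).

With `R` the rotation by one, the vertices are the cycles of `π⁻¹ R⁻¹ π R`, a product of two full
cycles. Counting gluings thus amounts to counting factorizations of a permutation `κ` of `w` points
into two full cycles, where `κ` is `ν` completed by fixed points. Inserting a fixed point into a set
of `w` points multiplies the number of factorizations by `w`, which reduces everything to `F(ν) =
numFactorizations ν` on `n` points and gives the exact count `card_gluing`. By Burnside, few gluings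
have rotational symmetry (`card_gluing_le`), so the number of classes is `C * w.descFactorial n +
O(w ^ (n - 1))` with `C = F(ν) / (∏ (m i + 1) * (n - 1)!)`. Summing over `h * w ≤ a` gives `C / (n +
1) * ζ(n + 1) * a ^ (n + 1)` to leading order, by dominated convergence
(`tendsto_sum_Icc_sum_divisors`).

It remains to compute `F(ν)` (`mul_numFactorizations`). The alternating sum of the `χ_j(g)` is
`det(1 - g)` on the standard representation: `n` for a full cycle, `0` otherwise. So `n * F(ν)` is
the sum of `(-1)^j χ_j(ν c⁻¹)` over full cycles `c` and over `j`. The sum of all full cycles is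
central and acts on the `j`-th exterior power as the scalar `(-1)^j j! (n - 1 - j)!`
(`sum_fullCycles_eq_smul`), which leaves the sum of `j! (n - 1 - j)! χ_j(ν)`. -/

/-! ### Full cycles -/

/-- A permutation all of whose points lie in a single cycle. -/
def Equiv.Perm.IsFullCycle {α : Type*} (c : Equiv.Perm α) : Prop := ∀ x y, c.SameCycle x y

namespace Equiv.Perm

theorem exists_zmod_cycle {α : Type*} [Finite α] (c : Perm α) (x₀ : α) :
    ∃ w : ℕ, w ≠ 0 ∧ ∃ f : ZMod w → α, Function.Injective f ∧ (∀ i, f (i + 1) = c (f i)) ∧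
      (∀ k : ℤ, f k = (c ^ k) x₀) ∧ ∀ y, c.SameCycle x₀ y ↔ ∃ i, f i = y := by
  let E := (MulAction.orbitZPowersEquiv c x₀).symm
  have hE : ∀ k : ℤ, ((E (k : ZMod _) : MulAction.orbit (Subgroup.zpowers c) x₀) : α)
      = (c ^ k) x₀ := by
    intro k
    rw [MulAction.orbitZPowersEquiv_symm_apply' c x₀ k]
    rfl
  refine ⟨Function.minimalPeriod (c • ·) x₀, ?_, fun i => (E i : α),
    Subtype.val_injective.comp E.injective, ?_, hE, ?_⟩
  · exact (Function.minimalPeriod_pos_of_mem_periodicPts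
      (MulAction.injective c |>.mem_periodicPts x₀)).ne'
  · intro i
    obtain ⟨k, rfl⟩ := ZMod.intCast_surjective i
    have := hE (k + 1)
    rw [Int.cast_add, Int.cast_one] at this
    change ((E (k + 1) : MulAction.orbit (Subgroup.zpowers c) x₀) : α) = c (E (k : ZMod _))
    rw [this, hE, add_comm, zpow_add, zpow_one, mul_apply]
  · intro y
    constructor
    · rintro ⟨k, rfl⟩
      exact ⟨k, hE k⟩
    · rintro ⟨i, rfl⟩
      obtain ⟨k, rfl⟩ := ZMod.intCast_surjective i
      exact ⟨k, (hE k).symm⟩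

theorem IsFullCycle.exists_equiv {α : Type*} [Finite α] {c : Perm α} (hc : c.IsFullCycle)
    {w : ℕ} (hw : Nat.card α = w) (x₀ : α) : ∃ e : ZMod w ≃ α, (∀ i, e (i + 1) = c (e i)) ∧
      ∀ k : ℤ, e k = (c ^ k) x₀ := by
  subst hw
  obtain ⟨w, hw, f, hf, h1, h2, h3⟩ := exists_zmod_cycle c x₀
  have hs : Function.Surjective f := fun y => (h3 y).1 (hc _ _)
  have hcard : w = Nat.card α := by
    rw [← Nat.card_congr (Equiv.ofBijective f ⟨hf, hs⟩), Nat.card_zmod]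
  subst hcard
  exact ⟨Equiv.ofBijective f ⟨hf, hs⟩, h1, h2⟩

theorem isFullCycle_conj {α : Type*} {c : Perm α} (s : Perm α) :
    (s * c * s⁻¹).IsFullCycle ↔ c.IsFullCycle := by
  constructor
  · intro h x y
    have := h (s x) (s y)
    rw [sameCycle_conj] at this
    simpa using this
  · intro h x y
    rw [sameCycle_conj]
    exact h _ _

theorem isFullCycle_inv {α : Type*} {c : Perm α} : c⁻¹.IsFullCycle ↔ c.IsFullCycle := by
  simp only [IsFullCycle, sameCycle_inv]

end Equiv.Perm

/-! ### Traces on exterior powers -/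

/-- In the basis of the exterior power indexed by `j`-subsets, the diagonal entries are the
principal minors of size `j`; their sum is a coefficient of the characteristic polynomial up to
sign. -/
theorem exteriorPower.trace_map {V : Type*} [AddCommGroup V] [Module ℂ V] [FiniteDimensional ℂ V]
    (f : V →ₗ[ℂ] V) (j : ℕ) (hj : j ≤ Module.finrank ℂ V) :
    LinearMap.trace ℂ (⋀[ℂ]^j V) (exteriorPower.map j f) =
      (-1) ^ j * f.charpoly.coeff (Module.finrank ℂ V - j) := by
  set d := Module.finrank ℂ V
  let b : Module.Basis (Fin d) ℂ V := Module.finBasis ℂ V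
  have hM := Matrix.charpoly_coeff_eq_sum_minors (LinearMap.toMatrix b b f) j (by simpa using hj)
  rw [LinearMap.charpoly_toMatrix, Fintype.card_fin] at hM
  rw [hM, ← mul_assoc, ← mul_pow, neg_one_mul, neg_neg, one_pow, one_mul,
    LinearMap.trace_eq_matrix_trace ℂ (b.exteriorPower j), Matrix.trace]
  have hmem : ∀ s : Finset (Fin d), s ∈ Finset.univ.powersetCard j ↔
      s ∈ Set.powersetCard (Fin d) j := by
    intro s
    simp [Finset.mem_powersetCard, Set.powersetCard]
  rw [Finset.sum_subtype _ hmem fun s : Finset (Fin d) => ((LinearMap.toMatrix b b f).submatrix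
    (Subtype.val : s → Fin d) (Subtype.val : s → Fin d)).det]
  refine Finset.sum_congr rfl fun s _ => ?_
  rw [Matrix.diag_apply, LinearMap.toMatrix_apply, exteriorPower.basis_apply,
    exteriorPower.basis_repr_apply, exteriorPower.map_apply_ιMulti_family,
    exteriorPower.ιMulti_family, exteriorPower.ιMultiDual_apply_ιMulti, ← Matrix.det_transpose]
  have hs : (s : Finset (Fin d)).card = j := s.2
  -- The exterior basis enumerates each subset increasingly, whereas the minor is indexed by the
  -- subset itself.
  rw [← Matrix.det_submatrix_equiv_self ((s : Finset (Fin d)).orderIsoOfFin hs).toEquiv]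
  congr 1
  ext i k
  simp [LinearMap.toMatrix_apply, Set.powersetCard.ofFinEmbEquiv_symm_apply]

theorem extChar_eq_coeff {n j : ℕ} (hj : j ≤ Module.finrank ℂ ((Fin n → ℂ) ⧸ constLine n))
    (g : Equiv.Perm (Fin n)) :
    extChar n j g = (-1) ^ j * (standardRep n g).charpoly.coeff
      (Module.finrank ℂ ((Fin n → ℂ) ⧸ constLine n) - j) :=
  exteriorPower.trace_map _ _ hj

theorem finrank_constLine {n : ℕ} (hn : 0 < n) : Module.finrank ℂ (constLine n) = 1 := by
  apply finrank_span_singleton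
  intro h
  simpa using congrFun h ⟨0, hn⟩

theorem finrank_standard {n : ℕ} (hn : 0 < n) :
    Module.finrank ℂ ((Fin n → ℂ) ⧸ constLine n) = n - 1 := by
  have := Submodule.finrank_quotient_add_finrank (constLine n)
  rw [finrank_constLine hn, Module.finrank_fin_fun] at this
  omega

theorem permRep_single {n : ℕ} (g : Equiv.Perm (Fin n)) (k : Fin n) (t : ℂ) :
    permRep n g (Pi.single k t) = Pi.single (g k) t := by
  ext i
  change (Pi.single k t : Fin n → ℂ) (g⁻¹ i) = _
  simp only [Pi.single_apply]
  congr 1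
  rw [Equiv.Perm.inv_eq_iff_eq, eq_comm (a := i), eq_comm, eq_comm]

/-- The basis vector at `x₀` is cyclic: its first `n` images under `g` are distinct basis vectors.
So the minimal polynomial, a divisor of `X ^ n - 1`, has degree at least `n`, and coincides with
both polynomials. -/
theorem charpoly_permRep {n : ℕ} (hn : 0 < n) {g : Equiv.Perm (Fin n)} (hg : g.IsFullCycle) :
    (permRep n g).charpoly = Polynomial.X ^ n - 1 := by
  obtain ⟨e, he, hk⟩ := hg.exists_equiv (Nat.card_fin n) ⟨0, hn⟩
  set x₀ : Fin n := ⟨0, hn⟩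
  have : NeZero n := ⟨hn.ne'⟩
  have hinj : ∀ k l : ℕ, k < n → l < n → (g ^ k) x₀ = (g ^ l) x₀ → k = l := by
    intro k l hkn hln h
    have h1 := hk k
    have h2 := hk l
    rw [zpow_natCast] at h1 h2
    have h3 := e.injective ((h1.trans h).trans h2.symm)
    rw [Int.cast_natCast, Int.cast_natCast, ZMod.natCast_eq_natCast_iff'] at h3
    rwa [Nat.mod_eq_of_lt hkn, Nat.mod_eq_of_lt hln] at h3
  have hgn : g ^ n = 1 := by
    ext x
    obtain ⟨i, rfl⟩ := e.surjective x
    obtain ⟨k, rfl⟩ := ZMod.intCast_surjective i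
    rw [hk, ← zpow_natCast, ← Equiv.Perm.mul_apply, ← zpow_add, ← hk, Equiv.Perm.one_apply]
    simp [hk]
  set f := permRep n g
  have hpow : ∀ k : ℕ, f ^ k = permRep n (g ^ k) := fun k => (map_pow (permRep n) g k).symm
  have hdvd : minpoly ℂ f ∣ Polynomial.X ^ n - 1 := by
    apply minpoly.dvd
    simp [hpow, hgn]
  have hmon : (Polynomial.X ^ n - 1 : Polynomial ℂ).Monic := Polynomial.monic_X_pow_sub_C 1 hn.ne'
  have hint : IsIntegral ℂ f := Algebra.IsIntegral.isIntegral f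
  have hdeg : n ≤ (minpoly ℂ f).natDegree := by
    by_contra! hlt
    have h0 := congrArg (fun F : Module.End ℂ (Fin n → ℂ) => F (Pi.single x₀ 1))
      (minpoly.aeval ℂ f)
    have hlead : (minpoly ℂ f).coeff (minpoly ℂ f).natDegree = 1 := minpoly.monic hint
    simp only [Polynomial.aeval_eq_sum_range, LinearMap.sum_apply, LinearMap.smul_apply,
      LinearMap.zero_apply, hpow, permRep_single] at h0
    -- At this coordinate only the leading term survives, since the lower powers of `g` move `x₀`
    -- elsewhere; this yields `1 = 0`.
    have h1 := congrFun h0 ((g ^ (minpoly ℂ f).natDegree) x₀)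
    rw [Finset.sum_apply, Finset.sum_eq_single (minpoly ℂ f).natDegree] at h1
    · simp [hlead] at h1
    · intro k hkr hne
      rw [Finset.mem_range] at hkr
      rw [Pi.smul_apply, Pi.single_eq_of_ne, smul_zero]
      intro h
      exact hne (hinj _ _ (by omega) hlt h.symm)
    · simp
  have h1 : minpoly ℂ f = Polynomial.X ^ n - 1 := by
    symm
    apply Polynomial.eq_of_monic_of_dvd_of_natDegree_le (minpoly.monic hint) hmon hdvd
    rw [← Polynomial.C_1, Polynomial.natDegree_X_pow_sub_C]
    exact hdeg
  rw [← h1]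
  apply Polynomial.eq_of_monic_of_dvd_of_natDegree_le (minpoly.monic hint) f.charpoly_monic
    f.minpoly_dvd_charpoly
  rw [LinearMap.charpoly_natDegree, Module.finrank_fin_fun]
  exact hdeg

/-- Determinants multiply along the invariant line of constants, on which `g` acts trivially. -/
theorem charpoly_permRep_eq_mul {n : ℕ} (hn : 0 < n) (g : Equiv.Perm (Fin n)) :
    (permRep n g).charpoly = (Polynomial.X - 1) * (standardRep n g).charpoly := by
  apply Polynomial.funext
  intro t
  rw [Polynomial.eval_mul, LinearMap.eval_charpoly, LinearMap.eval_charpoly]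
  have hle : constLine n ≤ (constLine n).comap
      (algebraMap ℂ (Module.End ℂ (Fin n → ℂ)) t - permRep n g) := by
    intro x hx
    exact sub_mem (Submodule.smul_mem _ t hx) (constLine_le_comap n g hx)
  rw [LinearMap.det_eq_det_mul_det (constLine n) _ hle]
  congr 1
  · have : (algebraMap ℂ (Module.End ℂ (Fin n → ℂ)) t - permRep n g).restrict
        (p := constLine n) (q := constLine n) hle =
        (t - 1) • LinearMap.id := by
      ext ⟨x, hx⟩ i
      obtain ⟨a, rfl⟩ := Submodule.mem_span_singleton.1 hx
      change t * (a * 1) - a * 1 = (t - 1) * (a * 1)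
      ring
    rw [this, LinearMap.det_smul, finrank_constLine hn]
    simp
  · congr 1
    apply LinearMap.ext
    intro x
    obtain ⟨x, rfl⟩ := Submodule.mkQ_surjective _ x
    rfl

theorem charpoly_standardRep {n : ℕ} (hn : 0 < n) {g : Equiv.Perm (Fin n)} (hg : g.IsFullCycle) :
    (standardRep n g).charpoly = ∑ i ∈ Finset.range n, Polynomial.X ^ i := by
  have h := charpoly_permRep_eq_mul hn g
  rw [charpoly_permRep hn hg, ← mul_geom_sum] at h
  exact (mul_left_cancel₀ (by simpa using Polynomial.X_sub_C_ne_zero (1 : ℂ)) h).symm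

theorem extChar_isFullCycle {n j : ℕ} (hj : j < n) {g : Equiv.Perm (Fin n)} (hg : g.IsFullCycle) :
    extChar n j g = (-1) ^ j := by
  have hn : 0 < n := by omega
  rw [extChar_eq_coeff (by rw [finrank_standard hn]; omega), charpoly_standardRep hn hg,
    finrank_standard hn, Polynomial.finsetSum_coeff]
  simp only [Polynomial.coeff_X_pow]
  rw [Finset.sum_ite_eq, if_pos (by simp; omega), mul_one]

/-- The numbers `(-1)^j χ_j(g)` are the coefficients of the characteristic polynomial in reverse
order. The value at `1` detects full cycles. -/
theorem sum_extChar_eq_det {n : ℕ} (hn : 0 < n) (g : Equiv.Perm (Fin n)) :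
    ∑ j ∈ Finset.range n, (-1) ^ j * extChar n j g = (standardRep n g).charpoly.eval 1 := by
  have hd := finrank_standard hn
  rw [Polynomial.eval_eq_sum_range, LinearMap.charpoly_natDegree, hd, Nat.sub_add_cancel hn,
    ← Finset.sum_range_reflect]
  refine Finset.sum_congr rfl fun j hj => ?_
  rw [Finset.mem_range] at hj
  rw [extChar_eq_coeff (by omega), ← mul_assoc, ← mul_pow, hd, Nat.sub_sub_self (by omega)]
  simp

theorem sum_extChar_of_isFullCycle {n : ℕ} (hn : 0 < n) {g : Equiv.Perm (Fin n)}
    (hg : g.IsFullCycle) : ∑ j ∈ Finset.range n, (-1) ^ j * extChar n j g = n := by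
  rw [sum_extChar_eq_det hn, charpoly_standardRep hn hg]
  simp [Polynomial.eval_finsetSum]

/-- The indicator of one cycle is invariant, and nonconstant because there is another cycle; hence
`1` is an eigenvalue on the quotient by constants. -/
theorem sum_extChar_of_not_isFullCycle {n : ℕ} (hn : 0 < n) {g : Equiv.Perm (Fin n)}
    (hg : ¬ g.IsFullCycle) : ∑ j ∈ Finset.range n, (-1) ^ j * extChar n j g = 0 := by
  classical
  rw [sum_extChar_eq_det hn]
  simp only [Equiv.Perm.IsFullCycle, not_forall] at hg
  obtain ⟨x, y, hxy⟩ := hg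
  set u : Fin n → ℂ := fun z => if g.SameCycle x z then 1 else 0
  have hu : permRep n g u = u := by
    ext z
    change u (g⁻¹ z) = u z
    simp [u]
  have hne : (constLine n).mkQ u ≠ 0 := by
    intro h
    rw [Submodule.mkQ_apply, Submodule.Quotient.mk_eq_zero] at h
    obtain ⟨a, ha⟩ := Submodule.mem_span_singleton.1 h
    have h1 := congrFun ha x
    have h2 := congrFun ha y
    have hxx : g.SameCycle x x := Equiv.Perm.SameCycle.refl g x
    simp [u, hxy, hxx] at h1 h2
    simp [h1] at h2
  have hev : Module.End.HasEigenvalue (standardRep n g) 1 := by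
    apply Module.End.hasEigenvalue_of_hasEigenvector (x := (constLine n).mkQ u)
    refine ⟨Module.End.mem_eigenspace_iff.2 ?_, hne⟩
    rw [one_smul]
    change (constLine n).mkQ (permRep n g u) = _
    rw [hu]
  exact (Module.End.hasEigenvalue_iff_isRoot_charpoly _ _).1 hev

/-! ### The sum of all full cycles acts as a scalar on the exterior powers -/

/-- The image in `ℂ^n / ℂ` of the `k`-th vector of the standard basis. -/
noncomputable def stdVec (n : ℕ) (k : Fin n) : (Fin n → ℂ) ⧸ constLine n :=
  (constLine n).mkQ (Pi.single k 1)

theorem standardRep_stdVec {n : ℕ} (g : Equiv.Perm (Fin n)) (k : Fin n) :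
    standardRep n g (stdVec n k) = stdVec n (g k) := by
  change (constLine n).mkQ (permRep n g _) = _
  rw [permRep_single, stdVec]

theorem extStandardRep_ιMulti {n j : ℕ} (g : Equiv.Perm (Fin n)) (a : Fin j → Fin n) :
    extStandardRep n j g (exteriorPower.ιMulti ℂ j (stdVec n ∘ a)) =
      exteriorPower.ιMulti ℂ j (stdVec n ∘ g ∘ a) := by
  change exteriorPower.map j (standardRep n g) _ = _
  rw [exteriorPower.map_apply_ιMulti]
  congr 1
  funext i
  exact standardRep_stdVec g _

theorem span_stdVec (n : ℕ) : Submodule.span ℂ (Set.range (stdVec n)) = ⊤ := by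
  have h : Set.range (stdVec n) = (constLine n).mkQ '' Set.range fun k => Pi.single k 1 := by
    rw [← Set.range_comp]
    rfl
  have hb : Submodule.span ℂ (Set.range fun k : Fin n => (Pi.single k 1 : Fin n → ℂ)) = ⊤ := by
    have := (Pi.basisFun ℂ (Fin n)).span_eq
    rw [← this]
    congr 2
    funext k
    rw [Pi.basisFun_apply]
  rw [h, Submodule.span_image, hb, Submodule.map_top, Submodule.range_mkQ]

theorem span_ιMulti_stdVec (n j : ℕ) : Submodule.span ℂ
    (Set.range fun a : Fin j → Fin n => exteriorPower.ιMulti ℂ j (stdVec n ∘ a)) = ⊤ := by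
  rw [← exteriorPower.ιMulti_span_of_span ℂ j _ (span_stdVec n)]
  congr 1
  ext x
  constructor
  · rintro ⟨a, rfl⟩
    exact ⟨stdVec n ∘ a, Set.range_comp_subset_range _ _, rfl⟩
  · rintro ⟨v, hv, rfl⟩
    choose a ha using fun i => hv (Set.mem_range_self i)
    exact ⟨a, congrArg _ (funext ha)⟩

theorem ιMulti_eq_zero_of_not_injective {n j : ℕ} {a : Fin j → Fin n}
    (h : ¬ Function.Injective a) : exteriorPower.ιMulti ℂ j (stdVec n ∘ a) = 0 := by
  obtain ⟨i, k, hik, hne⟩ := by simpa [Function.Injective] using h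
  refine AlternatingMap.map_eq_zero_of_eq _ _ (i := i) (j := k) ?_ hne
  rw [Function.comp_apply, hik, Function.comp_apply]

/-- Indices drawn from the `j` values of `b` either repeat, which kills the wedge, or permute these
values, which changes only its sign. -/
theorem ιMulti_mem_span_of_range_subset {n j : ℕ} (b : Fin j ↪ Fin n) (a : Fin j → Fin n)
    (h : ∀ i, a i ∈ Set.range b) : exteriorPower.ιMulti ℂ j (stdVec n ∘ a) ∈
      Submodule.span ℂ {exteriorPower.ιMulti ℂ j (stdVec n ∘ b)} := by
  choose π hπ using h
  by_cases hinj : Function.Injective π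
  · let σ : Equiv.Perm (Fin j) := Equiv.ofBijective π (Finite.injective_iff_bijective.1 hinj)
    have : stdVec n ∘ a = (stdVec n ∘ b) ∘ σ := by
      funext i
      change stdVec n (a i) = stdVec n (b (π i))
      rw [hπ]
    rw [this, AlternatingMap.map_perm]
    exact Submodule.mem_span_singleton.2 ⟨((Equiv.Perm.sign σ : ℤ) : ℂ), by
      rw [Int.cast_smul_eq_zsmul]; rfl⟩
  · rw [ιMulti_eq_zero_of_not_injective (a := a)]
    · exact zero_mem (Submodule.span ℂ {exteriorPower.ιMulti ℂ j (stdVec n ∘ b)})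
    · intro h
      refine hinj fun i k hik => h ?_
      rw [← hπ, ← hπ, hik]

/-- The permutations fixing the range of `b` pointwise. -/
def fixingPerms {n j : ℕ} (b : Fin j ↪ Fin n) : Finset (Equiv.Perm (Fin n)) :=
  Finset.univ.filter fun g => ∀ i, g (b i) = b i

theorem mem_fixingPerms {n j : ℕ} {b : Fin j ↪ Fin n} {g : Equiv.Perm (Fin n)} :
    g ∈ fixingPerms b ↔ ∀ i, g (b i) = b i := by
  simp [fixingPerms]

theorem swap_mem_fixingPerms {n j : ℕ} {b : Fin j ↪ Fin n} {k l : Fin n}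
    (hk : k ∉ Set.range b) (hl : l ∉ Set.range b) : Equiv.swap k l ∈ fixingPerms b := by
  rw [mem_fixingPerms]
  intro i
  exact Equiv.swap_apply_of_ne_of_ne (fun h => hk ⟨i, h⟩) (fun h => hl ⟨i, h⟩)

theorem sum_fixingPerms_mul {n j : ℕ} {b : Fin j ↪ Fin n} {τ : Equiv.Perm (Fin n)}
    (hτ : τ ∈ fixingPerms b) {M : Type*} [AddCommMonoid M] (f : Equiv.Perm (Fin n) → M) :
    ∑ g ∈ fixingPerms b, f (g * τ) = ∑ g ∈ fixingPerms b, f g := by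
  rw [mem_fixingPerms] at hτ
  refine Finset.sum_equiv (Equiv.mulRight τ) (fun g => ?_) fun g _ => rfl
  simp [mem_fixingPerms, hτ]

theorem sum_fixingPerms_mul_left {n j : ℕ} {b : Fin j ↪ Fin n} {τ : Equiv.Perm (Fin n)}
    (hτ : τ ∈ fixingPerms b) {M : Type*} [AddCommMonoid M] (f : Equiv.Perm (Fin n) → M) :
    ∑ g ∈ fixingPerms b, f (τ * g) = ∑ g ∈ fixingPerms b, f g := by
  rw [mem_fixingPerms] at hτ
  refine Finset.sum_equiv (Equiv.mulLeft τ) (fun g => ?_) fun g _ => rfl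
  simp only [mem_fixingPerms, Equiv.coe_mulLeft, Equiv.Perm.mul_apply]
  refine forall_congr' fun i => ?_
  rw [← τ.injective.eq_iff, hτ i]

/-- The sum over the stabilizer is constant off the range of `b` and zero on it. Since the all-ones
vector dies in the quotient, it equals minus a multiple of the sum of the basis vectors in the
range. -/
theorem sum_stdVec_fixingPerms_mem {n j : ℕ} (b : Fin j ↪ Fin n) {q : Fin n}
    (hq : q ∉ Set.range b) : ∑ g ∈ fixingPerms b, stdVec n (g q) ∈
      Submodule.span ℂ (Set.range (stdVec n ∘ b)) := by
  set U : Fin n → ℂ := ∑ g ∈ fixingPerms b, Pi.single (g q) 1 with hU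
  have h1 : ∑ g ∈ fixingPerms b, stdVec n (g q) = (constLine n).mkQ U := by
    rw [hU, map_sum]
    rfl
  have hconst : ∀ k, k ∉ Set.range b → U k = U q := by
    intro k hk
    have h2 := sum_fixingPerms_mul_left (swap_mem_fixingPerms hk hq)
      fun g => (Pi.single (g q) 1 : Fin n → ℂ) q
    simp only [hU, Finset.sum_apply]
    rw [← h2]
    refine Finset.sum_congr rfl fun g _ => ?_
    simp only [Pi.single_apply, Equiv.Perm.mul_apply]
    congr 1
    rw [eq_comm (a := q), Equiv.swap_apply_eq_iff, Equiv.swap_apply_right, eq_comm (a := k)]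
  have h0 : ∀ i, U (b i) = 0 := by
    intro i
    simp only [hU, Finset.sum_apply]
    refine Finset.sum_eq_zero fun g hg => ?_
    rw [Pi.single_eq_of_ne]
    intro h
    rw [← mem_fixingPerms.1 hg i] at h
    exact hq ⟨i, g.injective h⟩
  have h2 : U = U q • (fun _ => 1) - ∑ i, U q • (Pi.single (b i) 1 : Fin n → ℂ) := by
    funext k
    rw [Pi.sub_apply, Finset.sum_apply]
    by_cases hk : k ∈ Set.range b
    · obtain ⟨i, rfl⟩ := hk
      rw [h0, Finset.sum_eq_single i]
      · simp
      · intro l _ hl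
        rw [Pi.smul_apply, Pi.single_eq_of_ne (b.injective.ne hl.symm), smul_zero]
      · simp
    · rw [hconst k hk, Finset.sum_eq_zero]
      · simp
      · intro i _
        rw [Pi.smul_apply, Pi.single_eq_of_ne (fun h => hk ⟨i, h.symm⟩), smul_zero]
  have h3 : (constLine n).mkQ (fun _ => 1) = 0 := by
    rw [Submodule.mkQ_apply, Submodule.Quotient.mk_eq_zero]
    exact Submodule.subset_span rfl
  rw [h1, h2, map_sub, map_smul, h3, smul_zero, zero_sub, map_sum]
  refine neg_mem (sum_mem fun i _ => ?_)
  rw [map_smul]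
  exact Submodule.smul_mem _ _ (Submodule.subset_span ⟨i, rfl⟩)

/-- Symmetrizing over the pointwise stabilizer of the range of `b` has one-dimensional image. If all
indices of the wedge lie in the range, every term is a multiple of the target. If two lie outside,
swapping them changes the sign of the sum, which therefore vanishes. If exactly one lies outside,
linearity in that slot reduces to `sum_stdVec_fixingPerms_mem`. -/
theorem sum_fixingPerms_ιMulti_mem {n j : ℕ} (b : Fin j ↪ Fin n) (a : Fin j → Fin n) :
    ∑ g ∈ fixingPerms b, extStandardRep n j g (exteriorPower.ιMulti ℂ j (stdVec n ∘ a)) ∈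
      Submodule.span ℂ {exteriorPower.ιMulti ℂ j (stdVec n ∘ b)} := by
  by_cases hinj : Function.Injective a
  swap
  · rw [ιMulti_eq_zero_of_not_injective hinj]
    simp
  by_cases hall : ∀ i, a i ∈ Set.range b
  · refine sum_mem fun g hg => ?_
    rw [extStandardRep_ιMulti]
    apply ιMulti_mem_span_of_range_subset
    intro i
    obtain ⟨k, hk⟩ := hall i
    exact ⟨k, by rw [Function.comp_apply, ← hk, mem_fixingPerms.1 hg k]⟩
  push Not at hall
  obtain ⟨p, hp⟩ := hall
  by_cases htwo : ∃ p', p' ≠ p ∧ a p' ∉ Set.range b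
  · obtain ⟨p', hne, hp'⟩ := htwo
    have h1 := sum_fixingPerms_mul (swap_mem_fixingPerms hp hp')
      fun g => extStandardRep n j g (exteriorPower.ιMulti ℂ j (stdVec n ∘ a))
    have h2 : ∀ g, extStandardRep n j (g * Equiv.swap (a p) (a p'))
        (exteriorPower.ιMulti ℂ j (stdVec n ∘ a)) =
        - extStandardRep n j g (exteriorPower.ιMulti ℂ j (stdVec n ∘ a)) := by
      intro g
      rw [map_mul, Module.End.mul_apply, extStandardRep_ιMulti]
      have : stdVec n ∘ Equiv.swap (a p) (a p') ∘ a = (stdVec n ∘ a) ∘ Equiv.swap p p' := by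
        funext i
        simp [hinj.swap_apply]
      rw [this, AlternatingMap.map_swap _ _ hne.symm, map_neg]
    simp only [h2, Finset.sum_neg_distrib] at h1
    set A := ∑ x ∈ fixingPerms b, extStandardRep n j x (exteriorPower.ιMulti ℂ j (stdVec n ∘ a))
    have h3 : (2 : ℂ) • A = 0 := by
      rw [two_smul]
      nth_rw 1 [← h1]
      exact neg_add_cancel A
    rw [(smul_eq_zero.1 h3).resolve_left two_ne_zero]
    exact zero_mem _
  · push Not at htwo
    have h1 : ∀ g ∈ fixingPerms b, extStandardRep n j g
        (exteriorPower.ιMulti ℂ j (stdVec n ∘ a)) =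
        (exteriorPower.ιMulti ℂ j).toMultilinearMap.toLinearMap (stdVec n ∘ a) p
          (stdVec n (g (a p))) := by
      intro g hg
      rw [extStandardRep_ιMulti, MultilinearMap.toLinearMap_apply]
      change _ = exteriorPower.ιMulti ℂ j _
      congr 1
      funext i
      rcases eq_or_ne i p with rfl | hi
      · simp
      · obtain ⟨k, hk⟩ := htwo i hi
        simp [hi, ← hk, mem_fixingPerms.1 hg k]
    rw [Finset.sum_congr rfl h1, ← map_sum]
    suffices h : Submodule.span ℂ (Set.range (stdVec n ∘ b)) ≤ (Submodule.span ℂ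
        {exteriorPower.ιMulti ℂ j (stdVec n ∘ b)}).comap
        ((exteriorPower.ιMulti ℂ j).toMultilinearMap.toLinearMap (stdVec n ∘ a) p) from
      h (sum_stdVec_fixingPerms_mem b hp)
    rw [Submodule.span_le]
    rintro _ ⟨i, rfl⟩
    change exteriorPower.ιMulti ℂ j (Function.update (stdVec n ∘ a) p ((stdVec n ∘ b) i)) ∈
      Submodule.span ℂ {exteriorPower.ιMulti ℂ j (stdVec n ∘ b)}
    have : Function.update (stdVec n ∘ a) p ((stdVec n ∘ b) i) =
        stdVec n ∘ Function.update a p (b i) := by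
      funext k
      rcases eq_or_ne k p with rfl | hk <;> simp [*]
    rw [this]
    apply ιMulti_mem_span_of_range_subset
    intro k
    rcases eq_or_ne k p with rfl | hk
    · simp
    · rw [Function.update_of_ne hk]
      exact htwo k hk

open Classical in
/-- The full cycles. -/
noncomputable def fullCycles (α : Type*) [Fintype α] : Finset (Equiv.Perm α) :=
  Finset.univ.filter fun c => c.IsFullCycle

theorem mem_fullCycles {α : Type*} [Fintype α] {c : Equiv.Perm α} :
    c ∈ fullCycles α ↔ c.IsFullCycle := by
  simp [fullCycles]

theorem commute_sum_fullCycles {n j : ℕ} (g : Equiv.Perm (Fin n)) :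
    extStandardRep n j g * ∑ c ∈ fullCycles (Fin n), extStandardRep n j c =
      (∑ c ∈ fullCycles (Fin n), extStandardRep n j c) * extStandardRep n j g := by
  rw [Finset.mul_sum, Finset.sum_mul]
  refine Finset.sum_equiv (MulAut.conj g).toEquiv (fun c => ?_) fun c _ => ?_
  · simp [mem_fullCycles, Equiv.Perm.isFullCycle_conj]
  · rw [← map_mul, ← map_mul]
    simp

/-- A direct substitute for irreducibility and Schur's lemma: the central element `z` preserves the
line of vectors obtained by symmetrization, spanned by the basic wedge `e`, hence scales `e`. The
translates of `e` span the representation and `z` commutes with translations. -/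
theorem exists_sum_fullCycles_eq_smul {n j : ℕ} (hj : j ≤ n) :
    ∃ s : ℂ, ∑ c ∈ fullCycles (Fin n), extStandardRep n j c = s • 1 := by
  set z := ∑ c ∈ fullCycles (Fin n), extStandardRep n j c with hz
  let b : Fin j ↪ Fin n := Fin.castLEEmb hj
  set e := exteriorPower.ιMulti ℂ j (stdVec n ∘ b) with he
  have hcomm : ∀ g x, extStandardRep n j g (z x) = z (extStandardRep n j g x) := fun g x =>
    LinearMap.congr_fun (commute_sum_fullCycles g) x
  have hq : ∀ x, ∑ g ∈ fixingPerms b, extStandardRep n j g x ∈ Submodule.span ℂ {e} := by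
    intro x
    have hx : x ∈ Submodule.span ℂ
      (Set.range fun a : Fin j → Fin n => exteriorPower.ιMulti ℂ j (stdVec n ∘ a)) := by
      rw [span_ιMulti_stdVec]
      trivial
    have := (Submodule.span_le (p := (Submodule.span ℂ {e}).comap
      (∑ g ∈ fixingPerms b, extStandardRep n j g))).2 (by
        rintro _ ⟨a, rfl⟩
        rw [SetLike.mem_coe, Submodule.mem_comap, LinearMap.sum_apply]
        exact sum_fixingPerms_ιMulti_mem b a) hx
    rwa [Submodule.mem_comap, LinearMap.sum_apply] at this
  have hfix : ∀ g ∈ fixingPerms b, extStandardRep n j g e = e := by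
    intro g hg
    rw [he, extStandardRep_ιMulti]
    congr 2
    funext i
    exact mem_fixingPerms.1 hg i
  have hcard : ((fixingPerms b).card : ℂ) ≠ 0 := by
    rw [Nat.cast_ne_zero, Finset.card_ne_zero]
    exact ⟨1, mem_fixingPerms.2 fun _ => rfl⟩
  have hze : z e ∈ Submodule.span ℂ {e} := by
    -- As `z` is central, `z e` is fixed by the stabilizer, so symmetrizing it only multiplies it by
    -- the order of the stabilizer.
    have h1 := hq (z e)
    rw [Finset.sum_congr rfl fun g hg => (hcomm g e).trans (congrArg z (hfix g hg)),
      Finset.sum_const, ← Nat.cast_smul_eq_nsmul ℂ] at h1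
    exact (Submodule.smul_mem_iff _ hcard).1 h1
  obtain ⟨s, hs⟩ := Submodule.mem_span_singleton.1 hze
  refine ⟨s, LinearMap.ext_on_range (span_ιMulti_stdVec n j) fun a => ?_⟩
  rw [LinearMap.smul_apply, Module.End.one_apply]
  by_cases hinj : Function.Injective a
  · obtain ⟨g, hg⟩ : ∃ g : Equiv.Perm (Fin n), g ∘ b = a := by
      have := Equiv.Perm.isMultiplyPretransitive (Fin n) j
      obtain ⟨g, hg⟩ := MulAction.exists_smul_eq (Equiv.Perm (Fin n)) b ⟨a, hinj⟩
      exact ⟨g, by rw [← Function.Embedding.coeFn_mk a hinj, ← hg]; rfl⟩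
    rw [← hg, ← extStandardRep_ιMulti, ← hcomm, ← he, ← hs, map_smul]
  · rw [ιMulti_eq_zero_of_not_injective hinj]
    simp

/-! ### Counting full cycles, and products of two full cycles -/

/-- A conjugator between two full cycles is determined by the image of one point, and this image is
arbitrary. -/
theorem card_conj_eq {α : Type*} [Fintype α] [DecidableEq α] [Nonempty α]
    {R c : Equiv.Perm α} (hR : R.IsFullCycle) (hc : c.IsFullCycle) :
    (Finset.univ.filter fun σ : Equiv.Perm α => σ * R * σ⁻¹ = c).card = Fintype.card α := by
  obtain ⟨x₀⟩ := ‹Nonempty α›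
  have hpow : ∀ σ : Equiv.Perm α, σ * R * σ⁻¹ = c → ∀ k : ℤ, σ ((R ^ k) x₀) = (c ^ k) (σ x₀) := by
    rintro σ rfl k
    rw [conj_zpow]
    simp
  refine Finset.card_bij (fun σ _ => σ x₀) (fun _ _ => Finset.mem_univ _) ?_ ?_
  · intro σ hσ τ hτ h
    rw [Finset.mem_filter] at hσ hτ
    ext y
    obtain ⟨k, rfl⟩ := hR x₀ y
    rw [hpow σ hσ.2, hpow τ hτ.2, h]
  · intro y _
    obtain ⟨e, he, hek⟩ := hR.exists_equiv rfl x₀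
    obtain ⟨f, hf, hfk⟩ := hc.exists_equiv rfl y
    have hes : ∀ i, R (e i) = e (i + 1) := fun i => (he i).symm
    refine ⟨e.symm.trans f, ?_, ?_⟩
    · rw [Finset.mem_filter, mul_inv_eq_iff_eq_mul]
      refine ⟨Finset.mem_univ _, Equiv.ext fun z => ?_⟩
      obtain ⟨i, rfl⟩ := e.surjective z
      simp [hes, hf]
    · have h1 := hek 0
      have h2 := hfk 0
      simp only [Int.cast_zero, zpow_zero, Equiv.Perm.one_apply] at h1 h2
      rw [Equiv.trans_apply, ← h1, Equiv.symm_apply_apply, h2]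

theorem isFullCycle_add_one (w : ℕ) : (Equiv.addRight (1 : ZMod w)).IsFullCycle := by
  intro x y
  obtain ⟨k, hk⟩ := ZMod.intCast_surjective (y - x)
  refine ⟨k, ?_⟩
  have h : ∀ k : ℤ, (Equiv.addRight (1 : ZMod w) ^ k) x = x + k := by
    intro k
    induction k using Int.induction_on with
    | zero => simp
    | succ k ih => rw [add_comm, zpow_add, Equiv.Perm.mul_apply, ih]; simp; ring
    | pred k ih =>
      rw [sub_eq_add_neg, add_comm, zpow_add, Equiv.Perm.mul_apply, ih, zpow_neg_one,
        Equiv.Perm.inv_eq_iff_eq]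
      simp
      ring
  rw [h, hk]
  ring

theorem exists_isFullCycle (α : Type*) [Fintype α] [Nonempty α] :
    ∃ R : Equiv.Perm α, R.IsFullCycle := by
  have : NeZero (Fintype.card α) := ⟨Fintype.card_ne_zero⟩
  have e : ZMod (Fintype.card α) ≃ α := Fintype.equivOfCardEq (ZMod.card _)
  refine ⟨e.permCongr (Equiv.addRight 1), fun x y => ?_⟩
  obtain ⟨k, hk⟩ := isFullCycle_add_one (Fintype.card α) (e.symm x) (e.symm y)
  refine ⟨k, ?_⟩
  have : e.permCongr (Equiv.addRight 1) ^ k = e.permCongr (Equiv.addRight 1 ^ k) :=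
    (map_zpow e.permCongrHom (Equiv.addRight 1) k).symm
  rw [this, Equiv.permCongr_apply, hk, Equiv.apply_symm_apply]

theorem sum_conj_isFullCycle {α : Type*} [Fintype α] [DecidableEq α] [Nonempty α]
    {R : Equiv.Perm α} (hR : R.IsFullCycle) (f : Equiv.Perm α → ℕ) :
    ∑ σ, f (σ * R * σ⁻¹) = Fintype.card α * ∑ c ∈ fullCycles α, f c := by
  have hmaps : ∀ σ ∈ (Finset.univ : Finset (Equiv.Perm α)), σ * R * σ⁻¹ ∈ fullCycles α :=
    fun σ _ => mem_fullCycles.2 ((Equiv.Perm.isFullCycle_conj σ).2 hR)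
  rw [← Finset.sum_fiberwise_of_maps_to hmaps, Finset.mul_sum]
  refine Finset.sum_congr rfl fun c hc => ?_
  rw [Finset.sum_congr rfl (g := fun _ => f c) (by simp +contextual), Finset.sum_const,
    card_conj_eq hR (mem_fullCycles.1 hc), smul_eq_mul]

theorem card_fullCycles (α : Type*) [Fintype α] [Nonempty α] :
    (fullCycles α).card = (Fintype.card α - 1).factorial := by
  classical
  obtain ⟨R, hR⟩ := exists_isFullCycle α
  have h := sum_conj_isFullCycle hR fun _ => 1
  have hpos : 0 < Fintype.card α := Fintype.card_pos
  rw [← Finset.card_eq_sum_ones, ← Finset.card_eq_sum_ones, Finset.card_univ,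
    Fintype.card_perm, ← Nat.mul_factorial_pred hpos.ne'] at h
  exact (Nat.eq_of_mul_eq_mul_left hpos h).symm

open Classical in
/-- The number of ways to write `κ` as a product of two full cycles. -/
noncomputable def numFactorizations {α : Type*} [Fintype α] (κ : Equiv.Perm α) : ℕ :=
  ((fullCycles α).filter fun c => (κ * c⁻¹).IsFullCycle).card

/-- The scalar is found from the trace: each of the `(n - 1)!` full cycles contributes `(-1)^j`, and
the dimension is `(n - 1).choose j`. -/
theorem sum_fullCycles_eq_smul {n j : ℕ} (hj : j < n) :
    ∑ c ∈ fullCycles (Fin n), extStandardRep n j c =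
      ((-1) ^ j * ((j.factorial : ℂ) * ((n - 1 - j).factorial : ℂ))) • 1 := by
  have : Nonempty (Fin n) := ⟨⟨0, by omega⟩⟩
  obtain ⟨s, hs⟩ := exists_sum_fullCycles_eq_smul hj.le
  have htr := congrArg (LinearMap.trace ℂ _) hs
  rw [map_sum, map_smul, LinearMap.trace_one, exteriorPower.finrank_eq,
    finrank_standard (by omega)] at htr
  have h1 : ∀ c ∈ fullCycles (Fin n), LinearMap.trace ℂ _ (extStandardRep n j c) = (-1) ^ j :=
    fun c hc => extChar_isFullCycle hj (mem_fullCycles.1 hc)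
  rw [Finset.sum_congr rfl h1, Finset.sum_const, card_fullCycles, Fintype.card_fin,
    nsmul_eq_mul, smul_eq_mul] at htr
  have hch : ((n - 1).choose j : ℂ) ≠ 0 :=
    Nat.cast_ne_zero.2 (Nat.choose_pos (by omega)).ne'
  have hfac : ((n - 1).choose j : ℂ) * j.factorial * (n - 1 - j).factorial = (n - 1).factorial := by
    exact_mod_cast Nat.choose_mul_factorial_mul_factorial (show j ≤ n - 1 by omega)
  rw [hs]
  congr 1
  apply mul_right_cancel₀ hch
  rw [← htr, ← hfac]
  ring

/-- The alternating sum of exterior characters serves as `n` times the indicator of full cycles,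
applied to `ν * c⁻¹`. Exchanging the sums and using that full cycles are closed under inversion
brings in the scalar of `sum_fullCycles_eq_smul`, and the two signs cancel. -/
theorem mul_numFactorizations {n : ℕ} (hn : 0 < n) (ν : Equiv.Perm (Fin n)) :
    (n : ℂ) * numFactorizations ν = ∑ j ∈ Finset.range n,
      (j.factorial : ℂ) * ((n - 1 - j).factorial : ℂ) * extChar n j ν := by
  classical
  have h1 : (n : ℂ) * numFactorizations ν = ∑ c ∈ fullCycles (Fin n),
      ∑ j ∈ Finset.range n, (-1) ^ j * extChar n j (ν * c⁻¹) := by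
    rw [numFactorizations, Finset.card_filter, Nat.cast_sum, Finset.mul_sum]
    refine Finset.sum_congr rfl fun c _ => ?_
    split_ifs with h
    · rw [sum_extChar_of_isFullCycle hn h, Nat.cast_one, mul_one]
    · rw [sum_extChar_of_not_isFullCycle hn h, Nat.cast_zero, mul_zero]
  rw [h1, Finset.sum_comm]
  refine Finset.sum_congr rfl fun j hj => ?_
  rw [Finset.mem_range] at hj
  rw [← Finset.mul_sum]
  have h2 : ∑ c ∈ fullCycles (Fin n), extChar n j (ν * c⁻¹) =
      ∑ c ∈ fullCycles (Fin n), extChar n j (ν * c) :=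
    Finset.sum_equiv (Equiv.inv _)
      (fun c => by simp [mem_fullCycles, Equiv.Perm.isFullCycle_inv]) fun _ _ => rfl
  have h3 : ∑ c ∈ fullCycles (Fin n), extChar n j (ν * c) =
      LinearMap.trace ℂ _ (extStandardRep n j ν * ∑ c ∈ fullCycles (Fin n),
        extStandardRep n j c) := by
    rw [Finset.mul_sum, map_sum]
    refine Finset.sum_congr rfl fun c _ => ?_
    rw [← map_mul]
    rfl
  rw [h2, h3, sum_fullCycles_eq_smul hj, mul_smul_one, map_smul, smul_eq_mul, ← mul_assoc,
    ← mul_assoc, ← mul_pow]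
  simp only [neg_mul_neg, mul_one, one_pow, one_mul]
  rfl

/-! ### Inserting a fixed point -/

namespace Equiv.Perm

/-- With `σ = 1` this says that a function unchanged by each step of `τ` is constant on its cycles.
-/
theorem SameCycle.map_of_forall {α β : Type*} {τ : Perm α} {σ : Perm β} {p : α → β}
    (h : ∀ z, σ.SameCycle (p z) (p (τ z))) {x y : α} (hxy : τ.SameCycle x y) :
    σ.SameCycle (p x) (p y) := by
  obtain ⟨k, rfl⟩ := hxy
  induction k using Int.induction_on with
  | zero => exact SameCycle.refl _ _
  | succ k ih =>
    rw [add_comm, zpow_add, mul_apply, zpow_one]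
    exact ih.trans (h _)
  | pred k ih =>
    refine ih.trans ?_
    have := (h ((τ ^ (-(k : ℤ) - 1)) x)).symm
    rwa [← mul_apply, ← zpow_one_add, add_sub_cancel] at this

variable {α : Type*} [DecidableEq α]

/-- Left multiplication by the swap inserts `none` into the arrow of `σ` that ends at `i`; no cycles
are merged or split. -/
theorem isFullCycle_swap_mul_optionCongr (i : α) (σ : Perm α) :
    (swap none (some i) * optionCongr σ).IsFullCycle ↔ σ.IsFullCycle := by
  set τ := swap none (some i) * optionCongr σ
  have h0 : τ none = some i := by simp [τ]
  have h1 : ∀ a, σ a = i → τ (some a) = none := by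
    intro a h
    simp [τ, h]
  have h2 : ∀ a, σ a ≠ i → τ (some a) = some (σ a) := by
    intro a h
    simp only [τ, mul_apply, optionCongr_apply, Option.map_some]
    exact swap_apply_of_ne_of_ne (by simp) (by simpa using h)
  constructor
  · intro h x y
    refine SameCycle.map_of_forall (p := fun z : Option α => z.getD i) ?_ (h (some x) (some y))
    rintro (_ | a)
    · rw [h0]
      exact SameCycle.refl _ _
    · by_cases ha : σ a = i
      · rw [h1 a ha]
        exact ⟨1, ha⟩
      · rw [h2 a ha]
        exact ⟨1, rfl⟩
  · intro h
    have hs : ∀ a, τ.SameCycle (some a) (some (σ a)) := by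
      intro a
      by_cases ha : σ a = i
      · refine ⟨2, ?_⟩
        rw [zpow_two, mul_apply, h1 a ha, h0, ha]
      · exact ⟨1, h2 a ha⟩
    have hn : τ.SameCycle none (some i) := ⟨1, h0⟩
    have key : ∀ z, τ.SameCycle (some i) z := by
      rintro (_ | a)
      · exact hn.symm
      · exact SameCycle.map_of_forall hs (h i a)
    exact fun x y => (key x).symm.trans (key y)

theorem isFullCycle_mul_swap {β : Type*} [DecidableEq β] (σ : Perm β) (x y : β) :
    (σ * swap x y).IsFullCycle ↔ (swap x y * σ).IsFullCycle := by
  rw [← isFullCycle_conj (swap x y) (c := σ * swap x y)]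
  simp [mul_assoc]

theorem isFullCycle_permCongr {β γ : Type*} (e : β ≃ γ) (σ : Perm β) :
    (e.permCongr σ).IsFullCycle ↔ σ.IsFullCycle := by
  constructor
  · intro h x y
    have := SameCycle.map_of_forall (σ := σ) (p := e.symm) (fun z => ⟨1, by simp⟩) (h (e x) (e y))
    simpa using this
  · intro h x y
    have := SameCycle.map_of_forall (σ := e.permCongr σ) (p := e) (fun z => ⟨1, by simp⟩)
      (h (e.symm x) (e.symm y))
    simpa using this

theorem cycleType_optionCongr [Fintype α] (κ : Perm α) :
    Perm.cycleType (optionCongr κ) = κ.cycleType := by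
  rw [← cycleType_extendDomain (optionIsSomeEquiv α).symm]
  congr 1
  ext1 x
  rcases x with _ | a
  · rw [extendDomain_apply_not_subtype _ _ (by simp)]
    rfl
  · have := extendDomain_apply_image κ (optionIsSomeEquiv α).symm a
    simpa using this.symm

theorem cycleType_permCongr {β γ : Type*} [Fintype β] [DecidableEq β] [Fintype γ] [DecidableEq γ]
    (e : β ≃ γ) (κ : Perm β) : (e.permCongr κ).cycleType = κ.cycleType := by
  rw [← cycleType_extendDomain (e.trans (Equiv.subtypeUnivEquiv fun _ : γ => trivial).symm)]
  congr 1

end Equiv.Perm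

theorem numFactorizations_permCongr {α β : Type*} [Fintype α] [Fintype β] (e : α ≃ β)
    (κ : Equiv.Perm α) : numFactorizations (e.permCongr κ) = numFactorizations κ := by
  classical
  symm
  refine Finset.card_equiv e.permCongrHom.toEquiv fun c => ?_
  have h : e.permCongr κ * (e.permCongrHom.toEquiv c)⁻¹ = e.permCongr (κ * c⁻¹) := by
    rw [MulEquiv.toEquiv_eq_coe, MulEquiv.coe_toEquiv, ← map_inv]
    exact (map_mul e.permCongrHom κ c⁻¹).symm
  rw [Finset.mem_filter, Finset.mem_filter, mem_fullCycles, mem_fullCycles, h,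
    Equiv.Perm.isFullCycle_permCongr]
  exact and_congr_left' (Equiv.Perm.isFullCycle_permCongr e c).symm

/-- Every full cycle on `Option α` arises uniquely by inserting `none` before some `i` in a
permutation `c` of `α`. The complementary factor is then `κ * c⁻¹` with `none` inserted by the same
swap, so both factors are full cycles exactly when they were before the insertion. The choice of `i`
is free. -/
theorem numFactorizations_optionCongr {α : Type*} [Fintype α] [Nonempty α] (κ : Equiv.Perm α) :
    numFactorizations (Equiv.optionCongr κ) = Fintype.card α * numFactorizations κ := by
  classical
  rw [numFactorizations, numFactorizations, ← Finset.card_univ, ← Finset.card_product]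
  symm
  have hinv : ∀ (i : α) (c : Equiv.Perm α), Equiv.optionCongr κ *
      (Equiv.swap none (some i) * Equiv.optionCongr c)⁻¹ =
      Equiv.optionCongr (κ * c⁻¹) * Equiv.swap none (some i) := by
    intro i c
    rw [mul_inv_rev, Equiv.swap_inv, ← mul_assoc]
    congr 1
    exact (Equiv.optionCongr_trans c.symm κ).symm
  have hmem : ∀ (i : α) (c : Equiv.Perm α), Equiv.swap none (some i) * Equiv.optionCongr c ∈
      (fullCycles (Option α)).filter (fun c => Equiv.Perm.IsFullCycle (Equiv.optionCongr κ * c⁻¹)) ↔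
      c ∈ (fullCycles α).filter (fun c => (κ * c⁻¹).IsFullCycle) := by
    intro i c
    rw [Finset.mem_filter, Finset.mem_filter, mem_fullCycles, mem_fullCycles, hinv,
      Equiv.Perm.isFullCycle_mul_swap, Equiv.Perm.isFullCycle_swap_mul_optionCongr,
      Equiv.Perm.isFullCycle_swap_mul_optionCongr]
  refine Finset.card_bij (fun p _ => Equiv.swap none (some p.1) * Equiv.optionCongr p.2) ?_ ?_ ?_
  · rintro ⟨i, c⟩ hp
    exact (hmem i c).2 (Finset.mem_product.1 hp).2
  · rintro ⟨i, c⟩ _ ⟨i', c'⟩ _ h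
    have := Equiv.Perm.decomposeOption.symm.injective (a₁ := (some i, c)) (a₂ := (some i', c')) h
    simpa using this
  · intro c hc
    have hdec := Equiv.Perm.decomposeOption.symm_apply_apply c
    change Equiv.swap none (c none) * Equiv.optionCongr (Equiv.removeNone c) = c at hdec
    rcases hcn : c none with _ | i
    · exfalso
      obtain ⟨a⟩ := ‹Nonempty α›
      have hfull := mem_fullCycles.1 (Finset.mem_filter.1 hc).1
      obtain ⟨k, hk⟩ := hfull none (some a)
      rw [Equiv.Perm.zpow_apply_eq_self_of_apply_eq_self hcn] at hk
      simp at hk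
    · rw [hcn] at hdec
      refine ⟨(i, Equiv.removeNone c), ?_, hdec⟩
      rw [Finset.mem_product]
      refine ⟨Finset.mem_univ _, (hmem i _).1 ?_⟩
      rw [hdec]
      exact hc

theorem numFactorizations_fin {n : ℕ} (hn : 0 < n) (ν : Equiv.Perm (Fin n)) {w : ℕ} (hw : n ≤ w)
    (κ : Equiv.Perm (Fin w)) (h : κ.cycleType = ν.cycleType) :
    numFactorizations κ * (n - 1).factorial = (w - 1).factorial * numFactorizations ν := by
  induction w, hw using Nat.le_induction with
  | base =>
    obtain ⟨s, rfl⟩ := isConj_iff.1 (Equiv.Perm.isConj_iff_cycleType_eq.2 h.symm)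
    have := numFactorizations_permCongr s ν
    have h2 : s.permCongr ν = s * ν * s⁻¹ := by
      ext x
      simp
    rw [← h2, this, mul_comm]
  | succ w hw ih =>
    -- A fixed point exists because the support of `κ` is as large as that of `ν`, so it has at most
    -- `n < w + 1` points.
    obtain ⟨p, hp⟩ : ∃ p, κ p = p := by
      by_contra! hne
      have h1 : κ.support = Finset.univ := by
        ext x
        simp [hne x]
      have h2 := κ.sum_cycleType
      rw [h1, Finset.card_univ, Fintype.card_fin, h, ν.sum_cycleType] at h2
      have h3 := Finset.card_le_univ ν.support
      rw [Fintype.card_fin] at h3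
      omega
    let e := finSuccEquiv' p
    obtain ⟨κ', hκ'⟩ : ∃ κ' : Equiv.Perm (Fin w), e.permCongr κ = Equiv.optionCongr κ' := by
      have h0 : e.permCongr κ none = none := by
        simp [e, Equiv.permCongr_apply, hp]
      refine ⟨Equiv.removeNone (e.permCongr κ), ?_⟩
      rw [map_equiv_removeNone, h0, Equiv.swap_self, ← Equiv.Perm.one_def, one_mul]
    have hct : κ'.cycleType = ν.cycleType := by
      rw [← h, ← Equiv.Perm.cycleType_permCongr e κ, hκ', Equiv.Perm.cycleType_optionCongr]
    have : Nonempty (Fin w) := ⟨⟨0, by omega⟩⟩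
    rw [← numFactorizations_permCongr e κ, hκ', numFactorizations_optionCongr, Fintype.card_fin,
      mul_assoc, ih κ' hct, ← mul_assoc, Nat.mul_factorial_pred (by omega)]
    rfl

/-! ### Permutations with labelled cycles -/

/-- The labelling `ℓ` numbers cycles of `κ` of lengths `m i + 1`, among which are all the
nontrivial ones. -/
structure IsLabelling {r : ℕ} (m : Fin r → ℕ) {α : Type*} (κ : Equiv.Perm α)
    (ℓ : α → Option (Fin r)) : Prop where
  eq_iff : ∀ x y i, ℓ x = some i → (ℓ y = some i ↔ κ.SameCycle x y)
  card : ∀ i, Nat.card {x // ℓ x = some i} = m i + 1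
  regular : ∀ x, ℓ x = none → κ x = x

/-- Disjoint cyclic groups of orders `m i + 1`. -/
abbrev CyclePoints {r : ℕ} (m : Fin r → ℕ) : Type := Σ i, ZMod (m i + 1)

theorem card_cyclePoints {r : ℕ} (m : Fin r → ℕ) :
    Fintype.card (CyclePoints m) = ∑ i, (m i + 1) := by
  rw [Fintype.card_sigma]
  exact Finset.sum_congr rfl fun i _ => ZMod.card _

/-- The permutation rotating each of the cyclic groups. -/
def rotateCycles {r : ℕ} (m : Fin r → ℕ) : Equiv.Perm (CyclePoints m) :=
  Equiv.sigmaCongrRight fun _ => Equiv.addRight 1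

theorem rotateCycles_apply {r : ℕ} (m : Fin r → ℕ) (i : Fin r) (k : ZMod (m i + 1)) :
    rotateCycles m ⟨i, k⟩ = ⟨i, k + 1⟩ := rfl

section Labelling

variable {r : ℕ} {m : Fin r → ℕ} {α : Type*}

theorem IsLabelling.exists_framing [Finite α] {κ : Equiv.Perm α} {ℓ : α → Option (Fin r)}
    (h : IsLabelling m κ ℓ) (b : Fin r → α) (hb : ∀ i, ℓ (b i) = some i) :
    ∃ φ : CyclePoints m ↪ α, κ = (rotateCycles m).viaEmbedding φ ∧
      (∀ p, ℓ (φ p) = some p.1) ∧ (∀ x, x ∉ Set.range φ → ℓ x = none) ∧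
      ∀ i, φ ⟨i, 0⟩ = b i := by
  have hcyc : ∀ i, ∃ f : ZMod (m i + 1) → α, Function.Injective f ∧
      (∀ k, f (k + 1) = κ (f k)) ∧ f 0 = b i ∧ ∀ y, ℓ y = some i ↔ ∃ k, f k = y := by
    intro i
    obtain ⟨w, -, f, hf, h1, h2, h3⟩ := Equiv.Perm.exists_zmod_cycle κ (b i)
    have h4 : ∀ y, ℓ y = some i ↔ ∃ k, f k = y := fun y => (h.eq_iff _ y i (hb i)).trans (h3 y)
    obtain rfl : w = m i + 1 := by
      rw [← h.card i, ← Nat.card_zmod w]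
      refine Nat.card_congr ((Equiv.ofInjective f hf).trans (Equiv.subtypeEquivRight fun y => ?_))
      exact (h4 y).symm
    refine ⟨f, hf, h1, ?_, h4⟩
    have := h2 0
    simpa using this
  choose f hf h1 h0 h2 using hcyc
  have hℓ : ∀ i k, ℓ (f i k) = some i := fun i k => (h2 i _).2 ⟨k, rfl⟩
  let φ : CyclePoints m ↪ α := ⟨fun p => f p.1 p.2, by
    rintro ⟨i, k⟩ ⟨i', k'⟩ hk
    have hi := hℓ i k
    have hi' := hℓ i' k'
    change f i k = f i' k' at hk
    rw [hk, hi', Option.some_inj] at hi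
    subst hi
    rw [hf _ hk]⟩
  have hnone : ∀ x, x ∉ Set.range φ → ℓ x = none := by
    intro x hx
    by_contra hne
    obtain ⟨i, hi⟩ := Option.ne_none_iff_exists'.1 hne
    obtain ⟨k, hk⟩ := (h2 i x).1 hi
    exact hx ⟨⟨i, k⟩, hk⟩
  refine ⟨φ, ?_, fun p => hℓ _ _, hnone, h0⟩
  ext x
  by_cases hx : x ∈ Set.range φ
  · obtain ⟨⟨i, k⟩, rfl⟩ := hx
    rw [Equiv.Perm.viaEmbedding_apply, rotateCycles_apply]
    exact (h1 i k).symm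
  · rw [Equiv.Perm.viaEmbedding_apply_of_notMem _ _ _ hx, h.regular x (hnone x hx)]

open Classical in
/-- The labelling of the points in the range of `φ` by the number of their cycle. -/
noncomputable def framingLabel (φ : CyclePoints m ↪ α) (x : α) : Option (Fin r) :=
  if h : ∃ p, φ p = x then some h.choose.1 else none

theorem framingLabel_apply (φ : CyclePoints m ↪ α) (p : CyclePoints m) :
    framingLabel φ (φ p) = some p.1 := by
  have h : ∃ q, φ q = φ p := ⟨p, rfl⟩
  rw [framingLabel, dif_pos h, φ.injective h.choose_spec]

theorem framingLabel_of_notMem (φ : CyclePoints m ↪ α) {x : α} (hx : x ∉ Set.range φ) :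
    framingLabel φ x = none :=
  dif_neg hx

theorem framingLabel_eq_some_iff (φ : CyclePoints m ↪ α) {x : α} {i : Fin r} :
    framingLabel φ x = some i ↔ ∃ k, φ ⟨i, k⟩ = x := by
  constructor
  · intro h
    by_cases hx : x ∈ Set.range φ
    · obtain ⟨⟨i', k⟩, rfl⟩ := hx
      rw [framingLabel_apply, Option.some_inj] at h
      subst h
      exact ⟨k, rfl⟩
    · rw [framingLabel_of_notMem φ hx] at h
      simp at h
  · rintro ⟨k, rfl⟩
    exact framingLabel_apply φ _

theorem eq_framingLabel {φ : CyclePoints m ↪ α} {ℓ : α → Option (Fin r)}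
    (h : ∀ p, ℓ (φ p) = some p.1) (h' : ∀ x, x ∉ Set.range φ → ℓ x = none) :
    ℓ = framingLabel φ := by
  funext x
  by_cases hx : x ∈ Set.range φ
  · obtain ⟨p, rfl⟩ := hx
    rw [h, framingLabel_apply]
  · rw [h' x hx, framingLabel_of_notMem φ hx]

theorem isLabelling_framing (φ : CyclePoints m ↪ α) :
    IsLabelling m ((rotateCycles m).viaEmbedding φ) (framingLabel φ) where
  eq_iff x y i hx := by
    obtain ⟨k, rfl⟩ := (framingLabel_eq_some_iff φ).1 hx
    constructor
    · intro hy
      obtain ⟨l, rfl⟩ := (framingLabel_eq_some_iff φ).1 hy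
      refine Equiv.Perm.SameCycle.map_of_forall (p := fun k => φ ⟨i, k⟩) (fun z => ⟨1, ?_⟩)
        (isFullCycle_add_one (m i + 1) k l)
      rw [zpow_one, Equiv.Perm.viaEmbedding_apply, rotateCycles_apply]
      rfl
    · intro hs
      have := Equiv.Perm.SameCycle.map_of_forall (σ := 1) (p := framingLabel φ) (fun z => ?_) hs
      · rw [Equiv.Perm.sameCycle_one] at this
        rw [← this, hx]
      · rw [Equiv.Perm.sameCycle_one]
        by_cases hz : z ∈ Set.range φ
        · obtain ⟨⟨i, k⟩, rfl⟩ := hz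
          rw [Equiv.Perm.viaEmbedding_apply, rotateCycles_apply, framingLabel_apply,
            framingLabel_apply]
        · rw [Equiv.Perm.viaEmbedding_apply_of_notMem _ _ _ hz]
  card i := by
    rw [← Nat.card_zmod (m i + 1)]
    symm
    refine Nat.card_congr ((Equiv.ofInjective (fun k => φ ⟨i, k⟩) fun k l h => ?_).trans
      (Equiv.subtypeEquivRight fun y => ?_))
    · simpa using φ.injective h
    · exact (framingLabel_eq_some_iff φ).symm
  regular x hx := by
    apply Equiv.Perm.viaEmbedding_apply_of_notMem
    rintro ⟨p, rfl⟩
    rw [framingLabel_apply] at hx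
    simp at hx

/-- A framing is recovered from its permutation and the base points of its cycles; this gives
injectivity in `card_labelledPerm_mul`. -/
theorem framing_apply (φ : CyclePoints m ↪ α) (i : Fin r) (k : ℤ) :
    φ ⟨i, k⟩ = ((rotateCycles m).viaEmbedding φ ^ k) (φ ⟨i, 0⟩) := by
  have h : ∀ k : ZMod (m i + 1), (rotateCycles m).viaEmbedding φ (φ ⟨i, k⟩) = φ ⟨i, k + 1⟩ := by
    intro k
    rw [Equiv.Perm.viaEmbedding_apply, rotateCycles_apply]
  induction k using Int.induction_on with
  | zero => simp
  | succ k ih =>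
    rw [add_comm (k : ℤ), zpow_add, Equiv.Perm.mul_apply, ← ih, zpow_one, h]
    push_cast
    rw [add_comm]
  | pred k ih =>
    have h1 := h ((-(k : ℤ) - 1 : ℤ) : ZMod (m i + 1))
    rw [show ((-(k : ℤ) - 1 : ℤ) : ZMod (m i + 1)) + 1 = ((-k : ℤ) : ZMod (m i + 1)) by
      push_cast; ring, ih] at h1
    apply ((rotateCycles m).viaEmbedding φ).injective
    rw [h1, ← Equiv.Perm.mul_apply, ← zpow_one_add, add_sub_cancel]

/-- The permutations of `α` with cycles labelled according to `m`. -/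
abbrev LabelledPerm (m : Fin r → ℕ) (α : Type*) : Type _ :=
  {p : Equiv.Perm α × (α → Option (Fin r)) // IsLabelling m p.1 p.2}

/-- A labelled permutation with a base point on each labelled cycle is the same as an embedding of
the disjoint cyclic groups; the `i`-th base point has `m i + 1` choices. -/
theorem card_labelledPerm_mul [Fintype α] :
    Nat.card (LabelledPerm m α) * ∏ i, (m i + 1) =
      (Fintype.card α).descFactorial (∑ i, (m i + 1)) := by
  classical
  let F : (CyclePoints m ↪ α) →
      Σ p : LabelledPerm m α, (i : Fin r) → {x // p.1.2 x = some i} := fun φ =>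
    ⟨⟨((rotateCycles m).viaEmbedding φ, framingLabel φ), isLabelling_framing φ⟩,
      fun i => ⟨φ ⟨i, 0⟩, framingLabel_apply φ _⟩⟩
  have hF : Function.Bijective F := by
    constructor
    · intro φ ψ h
      have h1 : (rotateCycles m).viaEmbedding φ = (rotateCycles m).viaEmbedding ψ :=
        congrArg (fun q : Σ p : LabelledPerm m α, (i : Fin r) → {x // p.1.2 x = some i} =>
          q.1.1.1) h
      have h2 : (fun i => φ ⟨i, 0⟩) = fun i => ψ ⟨i, 0⟩ :=
        congrArg (fun q : Σ p : LabelledPerm m α, (i : Fin r) → {x // p.1.2 x = some i} =>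
          fun i => (q.2 i).1) h
      ext ⟨i, k⟩
      obtain ⟨k, rfl⟩ := ZMod.intCast_surjective k
      rw [framing_apply, framing_apply, h1, congrFun h2 i]
    · rintro ⟨⟨⟨κ, ℓ⟩, h⟩, b⟩
      obtain ⟨φ, h1, h2, h3, h4⟩ := h.exists_framing (fun i => (b i).1) fun i => (b i).2
      change κ = _ at h1
      obtain rfl : ℓ = _ := eq_framingLabel h2 h3
      subst h1
      refine ⟨φ, ?_⟩
      simp only [F, Sigma.mk.injEq, heq_eq_eq, true_and]
      funext i
      exact Subtype.ext (h4 i)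
  have hcard := Nat.card_congr (Equiv.ofBijective F hF)
  rw [Nat.card_eq_fintype_card, Fintype.card_embedding_eq, card_cyclePoints, Nat.card_sigma] at hcard
  rw [hcard, Finset.sum_congr rfl fun p _ => ?_, Finset.sum_const, Finset.card_univ,
    Nat.card_eq_fintype_card, smul_eq_mul]
  rw [Nat.card_pi]
  exact Finset.prod_congr rfl fun i _ => p.2.card i

theorem Equiv.Perm.IsFullCycle.cycleType_eq [Fintype α] [DecidableEq α] {c : Equiv.Perm α}
    (hc : c.IsFullCycle) :
    c.cycleType = if 2 ≤ Fintype.card α then {Fintype.card α} else 0 := by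
  split_ifs with h
  · have : Nontrivial α := Fintype.one_lt_card_iff_nontrivial.1 h
    have hne : ∀ x, c x ≠ x := by
      intro x hx
      obtain ⟨y, hy⟩ := exists_ne x
      obtain ⟨k, hk⟩ := hc x y
      rw [Equiv.Perm.zpow_apply_eq_self_of_apply_eq_self hx] at hk
      exact hy hk.symm
    obtain ⟨x⟩ : Nonempty α := inferInstance
    have hcyc : c.IsCycle := ⟨x, hne x, fun y _ => hc x y⟩
    rw [hcyc.cycleType]
    have : c.support = Finset.univ := by
      ext y
      simp [hne y]
    rw [this, Finset.card_univ]
  · rw [Equiv.Perm.cycleType_eq_zero]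
    have : Subsingleton α := Fintype.card_le_one_iff_subsingleton.1 (by omega)
    exact Subsingleton.elim _ _

/-- The cyclic groups are set in rotation one at a time, each rotation being disjoint from the
previous ones. Groups with `m i = 0` rotate trivially, hence the filter. -/
theorem cycleType_rotateCycles : (rotateCycles m).cycleType =
    ((Finset.univ.val.map fun i => m i + 1).filter fun k => 2 ≤ k) := by
  let ct : Fin r → Multiset ℕ := fun i => if 2 ≤ m i + 1 then {m i + 1} else 0
  let S : Finset (Fin r) → Equiv.Perm (CyclePoints m) := fun s =>
    Equiv.sigmaCongrRight fun i => if i ∈ s then Equiv.addRight 1 else 1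
  have hS : ∀ s, (S s).cycleType = ∑ i ∈ s, ct i := by
    intro s
    induction s using Finset.induction_on with
    | empty =>
      rw [Finset.sum_empty, Equiv.Perm.cycleType_eq_zero]
      ext1 ⟨i, k⟩
      simp [S]
    | insert i s hi ih =>
      let T : Equiv.Perm (CyclePoints m) :=
        (Equiv.addRight (1 : ZMod (m i + 1))).extendDomain (Equiv.sigmaSubtype (β := fun i => ZMod (m i + 1)) i).symm
      have hT1 : ∀ k, T ⟨i, k⟩ = ⟨i, k + 1⟩ := fun k =>
        Equiv.Perm.extendDomain_apply_image (Equiv.addRight (1 : ZMod (m i + 1)))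
          (Equiv.sigmaSubtype (β := fun i => ZMod (m i + 1)) i).symm k
      have hT2 : ∀ l k, l ≠ i → T ⟨l, k⟩ = ⟨l, k⟩ := fun l k hl =>
        Equiv.Perm.extendDomain_apply_not_subtype _ _ hl
      have hprod : S (insert i s) = T * S s := by
        ext1 ⟨l, k⟩
        rcases eq_or_ne l i with rfl | hl
        · simp [S, hi, hT1]
        · simp [S, hl, hT2]
      have hdisj : T.Disjoint (S s) := by
        rintro ⟨l, k⟩
        rcases eq_or_ne l i with rfl | hl
        · exact Or.inr (by simp [S, hi])
        · exact Or.inl (hT2 l k hl)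
      rw [hprod, hdisj.cycleType_mul, ih, Finset.sum_insert hi]
      congr 1
      rw [Equiv.Perm.cycleType_extendDomain, (isFullCycle_add_one _).cycleType_eq, ZMod.card]
  have h := hS Finset.univ
  have h1 : S Finset.univ = rotateCycles m := by
    ext1 ⟨i, k⟩
    simp [S, rotateCycles]
  rw [h1] at h
  rw [h]
  have key : ∀ t : Multiset (Fin r), (t.map ct).sum =
      (t.map fun i => m i + 1).filter fun k => 2 ≤ k := by
    intro t
    induction t using Multiset.induction_on with
    | empty => rfl
    | cons i t ih =>
      rw [Multiset.map_cons, Multiset.sum_cons, ih, Multiset.map_cons, Multiset.filter_cons]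
  exact key _

theorem IsLabelling.cycleType_eq [Fintype α] [DecidableEq α] {κ : Equiv.Perm α}
    {ℓ : α → Option (Fin r)} (h : IsLabelling m κ ℓ) : κ.cycleType =
      ((Finset.univ.val.map fun i => m i + 1).filter fun k => 2 ≤ k) := by
  classical
  have hb : ∀ i, ∃ x, ℓ x = some i := by
    intro i
    have : 0 < Nat.card {x // ℓ x = some i} := by
      rw [h.card]
      omega
    obtain ⟨x, hx⟩ := (Nat.card_pos_iff.1 this).1
    exact ⟨x, hx⟩
  choose b hb using hb
  obtain ⟨φ, rfl, -⟩ := h.exists_framing b hb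
  rw [← cycleType_rotateCycles]
  let : DecidablePred (· ∈ Set.range φ.toFun) := fun _ => Classical.propDecidable _
  exact Equiv.Perm.cycleType_extendDomain _

end Labelling

/-! ### Counting labelled gluings of the two boundary components of a cylinder -/

theorem IsLabelling.permCongr {r : ℕ} {m : Fin r → ℕ} {α β : Type*} {κ : Equiv.Perm α}
    {ℓ : α → Option (Fin r)} (h : IsLabelling m κ ℓ) (e : α ≃ β) :
    IsLabelling m (e.permCongr κ) (ℓ ∘ e.symm) where
  eq_iff x y i hx := by
    rw [Function.comp_apply, h.eq_iff _ (e.symm y) i hx]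
    constructor
    · intro hs
      simpa using Equiv.Perm.SameCycle.map_of_forall (σ := e.permCongr κ) (p := e)
        (fun z => ⟨1, by simp⟩) hs
    · exact Equiv.Perm.SameCycle.map_of_forall (fun z => ⟨1, by simp⟩)
  card i := by
    rw [← h.card i]
    exact Nat.card_congr (e.symm.subtypeEquiv fun _ => Iff.rfl)
  regular x hx := by
    rw [Equiv.permCongr_apply, h.regular _ hx, Equiv.apply_symm_apply]

/-- The number of labellings of a permutation. -/
noncomputable def numLabellings {r : ℕ} (m : Fin r → ℕ) {α : Type*} (κ : Equiv.Perm α) : ℕ :=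
  Nat.card {ℓ // IsLabelling m κ ℓ}

theorem numLabellings_conj {r : ℕ} (m : Fin r → ℕ) {α : Type*} (κ s : Equiv.Perm α) :
    numLabellings m (s * κ * s⁻¹) = numLabellings m κ := by
  have hs : ∀ (κ s : Equiv.Perm α), s * κ * s⁻¹ = s.permCongr κ := fun κ s => by
    ext x
    simp
  refine Nat.card_congr ((Equiv.arrowCongr s (Equiv.refl _)).subtypeEquiv fun ℓ => ?_).symm
  rw [hs]
  constructor
  · intro h
    exact h.permCongr s
  · intro h
    have := h.permCongr s.symm
    have h1 : s.symm.permCongr (s.permCongr κ) = κ := by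
      ext x
      simp
    have h2 : (Equiv.arrowCongr s (Equiv.refl _)) ℓ ∘ s.symm.symm = ℓ := by
      ext x
      simp
    rwa [h1, h2] at this

theorem card_subtype_prod_eq_sum {α β : Type*} [Fintype α] [Finite β] (P : α → β → Prop) :
    Nat.card {p : α × β // P p.1 p.2} = ∑ a, Nat.card {b // P a b} := by
  rw [← Nat.card_sigma]
  exact Nat.card_congr
    { toFun := fun p => ⟨p.1.1, p.1.2, p.2⟩
      invFun := fun p => ⟨(p.1, p.2.1), p.2.2⟩
      left_inv := fun _ => rfl
      right_inv := fun _ => rfl }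

/-- The vertices of a one-cylinder surface: `π` glues the top of the cylinder, whose unit segments
are numbered by `ZMod w`, to the bottom. -/
def vertexPerm {w : ℕ} (π : Equiv.Perm (ZMod w)) : Equiv.Perm (ZMod w) :=
  π⁻¹ * (Equiv.addRight 1)⁻¹ * π * Equiv.addRight 1

/-- The gluings of the top of a cylinder of width `w` to its bottom, with labelled vertices. -/
abbrev Gluing {r : ℕ} (m : Fin r → ℕ) (w : ℕ) : Type :=
  {p : Equiv.Perm (ZMod w) × (ZMod w → Option (Fin r)) // IsLabelling m (vertexPerm p.1) p.2}

theorem card_gluing {r : ℕ} {m : Fin r → ℕ} {n : ℕ} (hn : n = ∑ i, (m i + 1)) (hn0 : 0 < n)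
    {ν : Equiv.Perm (Fin n)} (hν : ν.partition.parts = Finset.univ.val.map fun i => m i + 1)
    (w : ℕ) [NeZero w] :
    Nat.card (Gluing m w) * ((∏ i, (m i + 1)) * (n - 1).factorial) =
      w * w.descFactorial n * numFactorizations ν := by
  classical
  have hw : 0 < w := NeZero.pos w
  set R : Equiv.Perm (ZMod w) := Equiv.addRight 1 with hRdef
  have hR : R.IsFullCycle := isFullCycle_add_one w
  set g : Equiv.Perm (ZMod w) → ℕ := numLabellings m with hg
  have hX : Nat.card (Gluing m w) = ∑ π, g (vertexPerm π) :=
    card_subtype_prod_eq_sum fun π ℓ => IsLabelling m (vertexPerm π) ℓ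
  have hL : Nat.card (LabelledPerm m (ZMod w)) = ∑ κ, g κ :=
    card_subtype_prod_eq_sum fun κ ℓ => IsLabelling m κ ℓ
  have h1 : w.factorial * ∑ π, g (vertexPerm π) =
      ∑ σ : Equiv.Perm (ZMod w), ∑ τ : Equiv.Perm (ZMod w),
        g (τ * R⁻¹ * τ⁻¹ * (σ * R * σ⁻¹)) := by
    have hcard : w.factorial = (Finset.univ : Finset (Equiv.Perm (ZMod w))).card := by
      rw [Finset.card_univ, Fintype.card_perm, ZMod.card]
    rw [hcard, ← smul_eq_mul, ← Finset.sum_const]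
    refine Finset.sum_congr rfl fun σ _ => ?_
    -- The substitution is `τ = σ * π⁻¹`.
    refine Fintype.sum_equiv ((Equiv.inv _).trans (Equiv.mulLeft σ)) _ _ fun π => ?_
    rw [hg, ← numLabellings_conj m _ σ]
    congr 1
    simp only [vertexPerm, hRdef, Equiv.trans_apply, Equiv.inv_apply, Equiv.coe_mulLeft]
    group
  have h2 : ∑ σ : Equiv.Perm (ZMod w), ∑ τ : Equiv.Perm (ZMod w),
        g (τ * R⁻¹ * τ⁻¹ * (σ * R * σ⁻¹)) =
      w * (w * ∑ c ∈ fullCycles (ZMod w), ∑ c' ∈ fullCycles (ZMod w), g (c' * c)) := by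
    have h := fun c => sum_conj_isFullCycle (Equiv.Perm.isFullCycle_inv.2 hR) fun c' => g (c' * c)
    simp only [ZMod.card] at h
    rw [Finset.sum_congr rfl fun σ _ => h _, ← Finset.mul_sum,
      sum_conj_isFullCycle hR fun c => ∑ c' ∈ fullCycles (ZMod w), g (c' * c), ZMod.card]
  have h3 : ∑ c ∈ fullCycles (ZMod w), ∑ c' ∈ fullCycles (ZMod w), g (c' * c) =
      ∑ κ, g κ * numFactorizations κ := by
    simp only [numFactorizations, Finset.card_filter, Finset.mul_sum]
    rw [Finset.sum_comm (s := Finset.univ)]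
    refine Finset.sum_congr rfl fun c _ => ?_
    have : ∀ κ, (g κ * if (κ * c⁻¹).IsFullCycle then 1 else 0) =
        if κ * c⁻¹ ∈ fullCycles (ZMod w) then g (κ * c⁻¹ * c) else 0 := by
      intro κ
      simp [mem_fullCycles]
    rw [Finset.sum_congr rfl fun κ _ => this κ, Fintype.sum_equiv (Equiv.mulRight c⁻¹)
      (fun κ => if κ * c⁻¹ ∈ fullCycles (ZMod w) then g (κ * c⁻¹ * c) else 0)
      (fun κ => if κ ∈ fullCycles (ZMod w) then g (κ * c) else 0) fun κ => rfl]
    simp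
  have hct : ∀ κ : Equiv.Perm (ZMod w), g κ ≠ 0 → n ≤ w ∧ κ.cycleType = ν.cycleType := by
    intro κ hκ
    obtain ⟨⟨ℓ, hℓ⟩⟩ := (Nat.card_pos_iff.1 (Nat.pos_of_ne_zero hκ)).1
    constructor
    · by_contra! hlt
      have := card_labelledPerm_mul (m := m) (α := ZMod w)
      rw [ZMod.card, ← hn, Nat.descFactorial_of_lt hlt, mul_eq_zero, Nat.card_eq_zero] at this
      rcases this with (h | h) | h
      · exact h.false ⟨(κ, ℓ), hℓ⟩
      · exact (not_finite_iff_infinite.2 h) inferInstance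
      · exact (Finset.prod_pos fun i _ => Nat.succ_pos (m i)).ne' h
    · rw [hℓ.cycleType_eq, ← hν, Equiv.Perm.filter_parts_partition_eq_cycleType]
  have h4 : (∑ κ, g κ * numFactorizations κ) * (n - 1).factorial =
      (w - 1).factorial * numFactorizations ν * ∑ κ, g κ := by
    rw [Finset.sum_mul, Finset.mul_sum]
    refine Finset.sum_congr rfl fun κ _ => ?_
    rcases eq_or_ne (g κ) 0 with h | h
    · simp [h]
    · obtain ⟨hnw, hc⟩ := hct κ h
      have e : ZMod w ≃ Fin w := Fintype.equivOfCardEq (by rw [ZMod.card, Fintype.card_fin])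
      have := numFactorizations_fin hn0 ν hnw (e.permCongr κ)
        (by rw [Equiv.Perm.cycleType_permCongr, hc])
      rw [numFactorizations_permCongr] at this
      rw [mul_assoc, this, mul_comm]
  have h5 := card_labelledPerm_mul (m := m) (α := ZMod w)
  rw [ZMod.card, ← hn, hL] at h5
  rw [h2, h3] at h1
  apply Nat.eq_of_mul_eq_mul_left (Nat.factorial_pos w)
  calc w.factorial * (Nat.card (Gluing m w) * ((∏ i, (m i + 1)) * (n - 1).factorial))
      = w * (w * ((∑ κ, g κ * numFactorizations κ) * (n - 1).factorial)) *
        (∏ i, (m i + 1)) := by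
        rw [hX, ← mul_assoc, h1]
        ring
    _ = w * (w * (w - 1).factorial) * numFactorizations ν *
        ((∑ κ, g κ) * (∏ i, (m i + 1))) := by
        rw [h4]
        ring
    _ = _ := by
        rw [h5, Nat.mul_factorial_pred hw.ne']
        ring

/-! ### Rotating a cylinder -/

section Rotation

variable {r : ℕ} {m : Fin r → ℕ} {w : ℕ}

/-- Translations commute with the rotation by one, so conjugating `π` conjugates the whole
commutator. -/
theorem vertexPerm_permCongr (s : ZMod w) (π : Equiv.Perm (ZMod w)) :
    vertexPerm ((Equiv.addRight s).permCongr π) = (Equiv.addRight s).permCongr (vertexPerm π) := by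
  have h : ∀ κ : Equiv.Perm (ZMod w), (Equiv.addRight s).permCongr κ =
      Equiv.addRight s * κ * (Equiv.addRight s)⁻¹ := fun κ => by
    ext x
    simp
  have hc : Commute (Equiv.addRight s : Equiv.Perm (ZMod w)) (Equiv.addRight 1) := by
    ext x
    simp only [Equiv.Perm.mul_apply, Equiv.coe_addRight]
    ring
  set R : Equiv.Perm (ZMod w) := Equiv.addRight 1 with hR
  rw [h, h, vertexPerm, vertexPerm, ← hR]
  have h1 : (Equiv.addRight s : Equiv.Perm (ZMod w))⁻¹ * R = R * (Equiv.addRight s)⁻¹ :=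
    hc.inv_left.eq
  have h2 : (Equiv.addRight s : Equiv.Perm (ZMod w))⁻¹ * R⁻¹ * Equiv.addRight s = R⁻¹ := by
    rw [hc.inv_inv.eq, inv_mul_cancel_right]
  calc _ = Equiv.addRight s * π⁻¹ * ((Equiv.addRight s)⁻¹ * R⁻¹ * Equiv.addRight s) * π *
        ((Equiv.addRight s)⁻¹ * R) := by simp only [mul_inv_rev, inv_inv, mul_assoc]
    _ = _ := by
      rw [h1, h2]
      simp only [mul_assoc]

/-- The base point of the circle `ZMod w` can be moved. -/
instance : AddAction (ZMod w) (Gluing m w) where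
  vadd s p := ⟨((Equiv.addRight s).permCongr p.1.1, p.1.2 ∘ (Equiv.addRight s).symm), by
    rw [vertexPerm_permCongr]
    exact p.2.permCongr _⟩
  zero_vadd p := by
    refine Subtype.ext (Prod.ext ?_ ?_)
    · ext x
      change p.1.1 (x + -0) + 0 = _
      simp
    · funext x
      change p.1.2 (x + -0) = _
      simp
  add_vadd s t p := by
    refine Subtype.ext (Prod.ext ?_ ?_)
    · ext x
      change p.1.1 (x + -(s + t)) + (s + t) = p.1.1 (x + -s + -t) + t + s
      ring_nf
    · funext x
      change p.1.2 (x + -(s + t)) = p.1.2 (x + -s + -t)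
      ring_nf

theorem vadd_gluing_fst (s : ZMod w) (p : Gluing m w) (x : ZMod w) :
    (s +ᵥ p).1.1 (x + s) = p.1.1 x + s := by
  change p.1.1 (x + s + -s) + s = _
  rw [add_neg_cancel_right]

theorem vadd_gluing_snd (s : ZMod w) (p : Gluing m w) (x : ZMod w) :
    (s +ᵥ p).1.2 (x + s) = p.1.2 x := by
  change p.1.2 (x + s + -s) = _
  rw [add_neg_cancel_right]

variable [NeZero w]

/-- The number of cylinders of width `w` with glued boundaries and labelled vertices, up to
rotation. -/
noncomputable def numRotationClasses (m : Fin r → ℕ) (w : ℕ) : ℕ :=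
  Nat.card (AddAction.orbitRel.Quotient (ZMod w) (Gluing m w))

/-- The equation for `π` says that `π⁻¹` conjugates `R⁻¹` to `κ * R⁻¹`, which has `w` solutions or
none. -/
theorem card_vertexPerm_fiber_le (κ : Equiv.Perm (ZMod w)) :
    Nat.card {π : Equiv.Perm (ZMod w) // vertexPerm π = κ} ≤ w := by
  classical
  by_cases hc : (κ * (Equiv.addRight 1)⁻¹).IsFullCycle
  · have h := card_conj_eq (Equiv.Perm.isFullCycle_inv.2 (isFullCycle_add_one w)) hc
    rw [ZMod.card] at h
    refine le_trans (le_of_eq ?_) h.le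
    rw [← Fintype.card_subtype, ← Nat.card_eq_fintype_card]
    refine Nat.card_congr ((Equiv.inv _).subtypeEquiv fun π => ?_)
    rw [Equiv.inv_apply, inv_inv, eq_mul_inv_iff_mul_eq, vertexPerm]
  · have : IsEmpty {π : Equiv.Perm (ZMod w) // vertexPerm π = κ} := by
      refine ⟨fun ⟨π, hπ⟩ => hc ?_⟩
      rw [← hπ, vertexPerm, mul_inv_cancel_right]
      have := (Equiv.Perm.isFullCycle_conj π⁻¹).2
        (Equiv.Perm.isFullCycle_inv.2 (isFullCycle_add_one w))
      rwa [inv_inv] at this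
    rw [Nat.card_of_isEmpty]
    exact Nat.zero_le _

/-- Once `q` is chosen, the value there is forced by the others: one degree of freedom is lost. -/
theorem card_framing_le (i₀ : Fin r) (s : ZMod w) :
    Nat.card {φ : CyclePoints m → ZMod w // ∃ q, q ≠ ⟨i₀, 0⟩ ∧ φ q = φ ⟨i₀, 0⟩ + s} ≤
      (∑ i, (m i + 1)) * w ^ (∑ i, (m i + 1) - 1) := by
  classical
  have hinj : ∀ q : CyclePoints m, Nat.card ({p : CyclePoints m // p ≠ q} → ZMod w) =
      w ^ (∑ i, (m i + 1) - 1) := by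
    intro q
    rw [Nat.card_eq_fintype_card, Fintype.card_fun, ZMod.card, Fintype.card_subtype_compl,
      card_cyclePoints, Fintype.card_subtype_eq]
  let F : {φ : CyclePoints m → ZMod w // ∃ q, q ≠ ⟨i₀, 0⟩ ∧ φ q = φ ⟨i₀, 0⟩ + s} →
      Σ q : CyclePoints m, ({p : CyclePoints m // p ≠ q} → ZMod w) := fun φ =>
    ⟨φ.2.choose, fun p => φ.1 p.1⟩
  have hF : Function.Injective F := by
    intro φ ψ h
    obtain ⟨hφ1, hφ2⟩ := φ.2.choose_spec
    obtain ⟨hψ1, hψ2⟩ := ψ.2.choose_spec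
    have hq : φ.2.choose = ψ.2.choose := congrArg Sigma.fst h
    have h1 : ∀ p, p ≠ φ.2.choose → φ.1 p = ψ.1 p := by
      intro p hp
      have := congrArg (fun z : Σ q : CyclePoints m, ({p : CyclePoints m // p ≠ q} → ZMod w) =>
        if h : p ≠ z.1 then z.2 ⟨p, h⟩ else 0) h
      simpa [F, hp, hq ▸ hp] using this
    refine Subtype.ext (funext fun p => ?_)
    by_cases hp : p = φ.2.choose
    · rw [hp]
      exact hφ2.trans ((congrArg (· + s) (h1 _ hφ1.symm)).trans
        (hψ2.symm.trans (congrArg ψ.1 hq.symm)))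
    · exact h1 p hp
  refine (Nat.card_le_card_of_injective F hF).trans ?_
  rw [Nat.card_sigma, Finset.sum_congr rfl fun q _ => hinj q, Finset.sum_const, Finset.card_univ,
    card_cyclePoints, smul_eq_mul]

/-- Invariance under `s` sends a point labelled `i₀` to another point with this label, so any
framing satisfies the constraint counted in `card_framing_le`. -/
theorem card_labelledPerm_invariant_le (i₀ : Fin r) {s : ZMod w} (hs : s ≠ 0) :
    Nat.card {p : LabelledPerm m (ZMod w) // ∀ x, p.1.2 (x + s) = p.1.2 x} ≤
      (∑ i, (m i + 1)) * w ^ (∑ i, (m i + 1) - 1) := by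
  classical
  refine le_trans ?_ (card_framing_le (m := m) i₀ s)
  have key : ∀ p : {p : LabelledPerm m (ZMod w) // ∀ x, p.1.2 (x + s) = p.1.2 x},
      ∃ φ : CyclePoints m ↪ ZMod w, p.1.1.1 = (rotateCycles m).viaEmbedding φ ∧
        p.1.1.2 = framingLabel φ := by
    rintro ⟨⟨⟨κ, ℓ⟩, h⟩, hinv⟩
    have hb : ∀ i, ∃ x, ℓ x = some i := by
      intro i
      have : 0 < Nat.card {x // ℓ x = some i} := by
        rw [h.card]
        omega
      obtain ⟨x, hx⟩ := (Nat.card_pos_iff.1 this).1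
      exact ⟨x, hx⟩
    choose b hb using hb
    obtain ⟨φ, h1, h2, h3, -⟩ := h.exists_framing b hb
    exact ⟨φ, h1, eq_framingLabel h2 h3⟩
  choose φ h1 h2 using key
  refine Nat.card_le_card_of_injective (fun p => ⟨φ p, ?_⟩) ?_
  · have h3 := p.2 (φ p ⟨i₀, 0⟩)
    rw [h2, framingLabel_apply, framingLabel_eq_some_iff] at h3
    obtain ⟨k, hk⟩ := h3
    refine ⟨⟨i₀, k⟩, ?_, hk⟩
    intro h0
    rw [h0] at hk
    exact hs (by simpa using hk)
  · intro p q hpq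
    have h3 : φ p = φ q := DFunLike.coe_injective (congrArg Subtype.val hpq)
    refine Subtype.ext (Subtype.ext (Prod.ext ?_ ?_))
    · rw [h1, h1, h3]
    · rw [h2, h2, h3]

theorem card_fixedBy_le (i₀ : Fin r) {s : ZMod w} (hs : s ≠ 0) :
    Nat.card (AddAction.fixedBy (Gluing m w) s) ≤
      (∑ i, (m i + 1)) * w ^ (∑ i, (m i + 1) - 1) * w := by
  classical
  let F : AddAction.fixedBy (Gluing m w) s →
      Σ p : {p : LabelledPerm m (ZMod w) // ∀ x, p.1.2 (x + s) = p.1.2 x},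
        {π : Equiv.Perm (ZMod w) // vertexPerm π = p.1.1.1} := fun p =>
    ⟨⟨⟨(vertexPerm p.1.1.1, p.1.1.2), p.1.2⟩, fun x => by
      have h1 := vadd_gluing_snd s p.1 x
      rwa [show s +ᵥ p.1 = p.1 from p.2] at h1⟩, p.1.1.1, rfl⟩
  have hF : Function.Injective F := by
    intro p q h
    have h1 := congrArg (fun z : Σ p : {p : LabelledPerm m (ZMod w) //
      ∀ x, p.1.2 (x + s) = p.1.2 x}, {π : Equiv.Perm (ZMod w) // vertexPerm π = p.1.1.1} =>
      (z.2.1, z.1.1.1.2)) h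
    exact Subtype.ext (Subtype.ext h1)
  refine (Nat.card_le_card_of_injective F hF).trans ?_
  rw [Nat.card_sigma]
  refine (Finset.sum_le_card_nsmul _ _ _ fun p _ => card_vertexPerm_fiber_le _).trans ?_
  rw [smul_eq_mul, Finset.card_univ, ← Nat.card_eq_fintype_card]
  exact Nat.mul_le_mul_right _ (card_labelledPerm_invariant_le i₀ hs)

/-- Translation by `s` permutes the `m i₀ + 1` points labelled `i₀`; comparing their sums gives the
relation. Thus the number of shifts with fixed gluings is bounded independently of `w`. -/
theorem nsmul_eq_zero_of_mem_fixedBy (i₀ : Fin r) {s : ZMod w} {p : Gluing m w}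
    (hp : p ∈ AddAction.fixedBy (Gluing m w) s) : (m i₀ + 1) • s = 0 := by
  classical
  have hinv : ∀ x, p.1.2 (x + s) = p.1.2 x := fun x => by
    have h1 := vadd_gluing_snd s p x
    rwa [show s +ᵥ p = p from hp] at h1
  set D : Finset (ZMod w) := Finset.univ.filter fun x => p.1.2 x = some i₀ with hD
  have hcard : D.card = m i₀ + 1 := by
    rw [← p.2.card i₀, hD, ← Fintype.card_subtype, ← Nat.card_eq_fintype_card]
  have h1 : ∑ x ∈ D, (x + s) = ∑ x ∈ D, x :=
    Finset.sum_equiv (Equiv.addRight s) (fun x => by simp [hD, hinv]) fun x _ => rfl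
  rw [Finset.sum_add_distrib, Finset.sum_const, hcard] at h1
  simpa using h1

/-- Burnside's formula: the zero shift fixes all gluings, and at most `m i₀ + 1` shifts fix any.
Without this bound on the number of shifts the error would be of the order of the main term. -/
theorem card_gluing_le (m : Fin r → ℕ) (w : ℕ) [NeZero w] :
    Nat.card (Gluing m w) ≤ numRotationClasses m w * w ∧ (∀ _ : Fin r,
    numRotationClasses m w * w ≤ Nat.card (Gluing m w) +
      (∑ i, (m i + 1)) * ((∑ i, (m i + 1)) * w ^ (∑ i, (m i + 1) - 1) * w)) := by
  classical
  have : Fintype (AddAction.orbitRel.Quotient (ZMod w) (Gluing m w)) := Fintype.ofFinite _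
  have : ∀ s : ZMod w, Fintype (AddAction.fixedBy (Gluing m w) s) := fun s => Fintype.ofFinite _
  have hB := AddAction.sum_card_fixedBy_eq_card_orbits_mul_card_addGroup (ZMod w) (Gluing m w)
  rw [ZMod.card, ← Nat.card_eq_fintype_card] at hB
  change _ = numRotationClasses m w * w at hB
  rw [← hB, ← Finset.add_sum_erase _ _ (Finset.mem_univ (0 : ZMod w))]
  have h0 : Fintype.card (AddAction.fixedBy (Gluing m w) (0 : ZMod w)) =
      Nat.card (Gluing m w) := by
    rw [← Nat.card_eq_fintype_card]
    refine Nat.card_congr (Equiv.subtypeUnivEquiv fun p => ?_)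
    exact zero_vadd _ p
  rw [h0]
  refine ⟨Nat.le_add_right _ _, fun i₀ => Nat.add_le_add_left ?_ _⟩
  set N := ∑ i, (m i + 1)
  have hle : ∀ s ∈ Finset.univ.erase (0 : ZMod w),
      Fintype.card (AddAction.fixedBy (Gluing m w) s) ≤
        if (m i₀ + 1) • s = 0 then N * w ^ (N - 1) * w else 0 := by
    intro s hs
    rw [← Nat.card_eq_fintype_card]
    split_ifs with h
    · exact card_fixedBy_le i₀ (Finset.ne_of_mem_erase hs)
    · rw [Nat.le_zero, Nat.card_eq_zero]
      exact Or.inl ⟨fun p => h (nsmul_eq_zero_of_mem_fixedBy i₀ p.2)⟩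
  refine (Finset.sum_le_sum hle).trans ?_
  rw [← Finset.sum_filter, Finset.sum_const, smul_eq_mul]
  refine Nat.mul_le_mul_right _ ?_
  calc _ ≤ (Finset.univ.filter fun s : ZMod w => (m i₀ + 1) • s = 0).card :=
        Finset.card_le_card (Finset.filter_subset_filter _ (Finset.erase_subset _ _))
    _ ≤ m i₀ + 1 := IsAddCyclic.card_nsmul_eq_zero_le (Nat.succ_pos _)
    _ ≤ N := Finset.single_le_sum (f := fun i => m i + 1) (fun _ _ => Nat.zero_le _)
        (Finset.mem_univ i₀)

end Rotation

/-! ### One-cylinder square-tiled surfaces -/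

namespace SquareTiledSurface

variable {r : ℕ} {m : Fin r → ℕ} {N : ℕ}

theorem isLabelling (S : SquareTiledSurface m N) :
    IsLabelling m (S.up⁻¹ * S.right⁻¹ * S.up * S.right) S.zero :=
  ⟨S.zero_eq_iff, S.card_zero, S.regular⟩

theorem _root_.Equiv.permCongr_commutator {α β : Type*} (e : α ≃ β) (R U : Equiv.Perm α) :
    e.permCongr (U⁻¹ * R⁻¹ * U * R) =
      (e.permCongr U)⁻¹ * (e.permCongr R)⁻¹ * e.permCongr U * e.permCongr R := by
  change e.permCongrHom _ = (e.permCongrHom U)⁻¹ * (e.permCongrHom R)⁻¹ * e.permCongrHom U *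
    e.permCongrHom R
  simp only [map_mul, map_inv]

/-- The square-tiled surface with squares numbered by an arbitrary type. -/
def ofEquiv {α : Type*} (e : α ≃ Fin N) (R U : Equiv.Perm α) (Z : α → Option (Fin r))
    (hc : ∀ x y, ∃ σ ∈ Subgroup.closure {R, U}, σ x = y)
    (hl : IsLabelling m (U⁻¹ * R⁻¹ * U * R) Z) : SquareTiledSurface m N where
  right := e.permCongr R
  up := e.permCongr U
  zero := Z ∘ e.symm
  connected x y := by
    obtain ⟨σ, hσ, h⟩ := hc (e.symm x) (e.symm y)
    refine ⟨e.permCongr σ, ?_, by simp [h]⟩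
    have h1 := Subgroup.mem_map_of_mem (e.permCongrHom : Equiv.Perm α →* Equiv.Perm (Fin N)) hσ
    rw [MonoidHom.map_closure, Set.image_pair] at h1
    exact h1
  zero_eq_iff := Equiv.permCongr_commutator e R U ▸ (hl.permCongr e).eq_iff
  card_zero := (hl.permCongr e).card
  regular := Equiv.permCongr_commutator e R U ▸ (hl.permCongr e).regular

theorem iso_ofEquiv {α β : Type*} {e : α ≃ Fin N} {R U : Equiv.Perm α} {Z : α → Option (Fin r)}
    {hc : ∀ x y, ∃ σ ∈ Subgroup.closure {R, U}, σ x = y}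
    {hl : IsLabelling m (U⁻¹ * R⁻¹ * U * R) Z}
    {e' : β ≃ Fin N} {R' U' : Equiv.Perm β} {Z' : β → Option (Fin r)}
    {hc' : ∀ x y, ∃ σ ∈ Subgroup.closure {R', U'}, σ x = y}
    {hl' : IsLabelling m (U'⁻¹ * R'⁻¹ * U' * R') Z'} :
    Iso (ofEquiv e R U Z hc hl) (ofEquiv e' R' U' Z' hc' hl') ↔
      ∃ E : α ≃ β, ∀ x, E (R x) = R' (E x) ∧ E (U x) = U' (E x) ∧ Z' (E x) = Z x := by
  constructor
  · rintro ⟨f, hf⟩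
    refine ⟨(e.trans f).trans e'.symm, fun x => ?_⟩
    obtain ⟨h1, h2, h3⟩ := hf (e x)
    simp only [ofEquiv, Equiv.permCongr_apply, Equiv.symm_apply_apply, Function.comp_apply]
      at h1 h2 h3
    simp only [Equiv.trans_apply, h1, h2, h3, Equiv.symm_apply_apply, and_self]
  · rintro ⟨E, hE⟩
    refine ⟨(e.symm.trans E).trans e', fun x => ?_⟩
    obtain ⟨h1, h2, h3⟩ := hE (e.symm x)
    simp [ofEquiv, h1, h2, h3]

theorem iso_ofEquiv_of_forall (S : SquareTiledSurface m N) {α : Type*} {e : α ≃ Fin N}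
    {R U : Equiv.Perm α} {Z : α → Option (Fin r)}
    (hc : ∀ x y, ∃ σ ∈ Subgroup.closure {R, U}, σ x = y)
    (hl : IsLabelling m (U⁻¹ * R⁻¹ * U * R) Z) (E : α ≃ Fin N)
    (h : ∀ x, E (R x) = S.right (E x) ∧ E (U x) = S.up (E x) ∧ S.zero (E x) = Z x) :
    Iso (ofEquiv e R U Z hc hl) S := by
  refine ⟨e.symm.trans E, fun x => ?_⟩
  obtain ⟨h1, h2, h3⟩ := h (e.symm x)
  simp [ofEquiv, h1, h2, h3]

theorem numCylinders_eq_one_iff {S : SquareTiledSurface m N} (hN : 0 < N) :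
    S.numCylinders = 1 ↔ ∀ x y, Relation.EqvGen S.CylinderStep x y := by
  rw [numCylinders, Nat.card_eq_one_iff_unique]
  constructor
  · rintro ⟨h, -⟩ x y
    exact Quotient.exact (s := Relation.EqvGen.setoid S.CylinderStep) (h.elim _ _)
  · intro h
    refine ⟨⟨fun a b => ?_⟩, ⟨Quotient.mk (Relation.EqvGen.setoid S.CylinderStep) ⟨0, hN⟩⟩⟩
    induction a using Quotient.inductionOn
    induction b using Quotient.inductionOn
    exact Quotient.sound (s := Relation.EqvGen.setoid S.CylinderStep) (h _ _)

theorem TopRegular.of_sameCycle {S : SquareTiledSurface m N} {x y : Fin N} (h : S.TopRegular x)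
    (hxy : S.right.SameCycle x y) : S.TopRegular y :=
  fun z hz => h z (hxy.trans hz)

/-- A regular corner is a fixed point of the commutator, so going around it closes up. -/
theorem TopRegular.up_right {S : SquareTiledSurface m N} {x : Fin N} (h : S.TopRegular x) :
    S.up (S.right x) = S.right (S.up x) := by
  have h1 := S.regular x (h x (Equiv.Perm.SameCycle.refl _ _))
  simp only [Equiv.Perm.mul_apply] at h1
  rw [Equiv.Perm.inv_eq_iff_eq, Equiv.Perm.inv_eq_iff_eq] at h1
  exact h1

/-- If the surface has a single cylinder then its squares are arranged in a rectangle, the top row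
being the one of a zero. -/
theorem exists_rectangle (S : SquareTiledSurface m N)
    (h1 : ∀ x y, Relation.EqvGen S.CylinderStep x y) (i₀ : Fin r) :
    ∃ (h w : ℕ) (_ : NeZero h) (_ : NeZero w) (E : ZMod h × ZMod w ≃ Fin N),
      (∀ k i, S.right (E (k, i)) = E (k, i + 1)) ∧
      (∀ k i, k ≠ 0 → S.up (E (k, i)) = E (k - 1, i)) ∧
      ∀ k i, k ≠ 0 → S.zero (E (k, i)) = none := by
  obtain ⟨x₀, hx₀⟩ : ∃ x, S.zero x = some i₀ := by
    have : 0 < Nat.card {x // S.zero x = some i₀} := by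
      rw [S.card_zero]
      omega
    obtain ⟨x, hx⟩ := (Nat.card_pos_iff.1 this).1
    exact ⟨x, hx⟩
  obtain ⟨w, hw, f, hf, hf1, hf2, hf3⟩ := Equiv.Perm.exists_zmod_cycle S.right x₀
  have hw' : NeZero w := ⟨hw⟩
  have hf0 : f 0 = x₀ := by simpa using hf2 0
  -- Rows are numbered downwards from the row of `x₀`, whose upper boundary carries the zero `i₀`.
  set F : ℕ → ZMod w → Fin N := fun k i => (S.up⁻¹ ^ k) (f i) with hF
  have hup : ∀ k i, S.up (F (k + 1) i) = F k i := by
    intro k i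
    simp only [hF]
    rw [pow_succ', Equiv.Perm.mul_apply, ← Equiv.Perm.eq_inv_iff_eq]
  have hnot0 : ∀ i, ¬ S.TopRegular (F 0 i) := by
    intro i hi
    have := hi x₀ ((hf3 _).2 ⟨i, rfl⟩).symm
    rw [hx₀] at this
    simp at this
  have hstep : ∀ k, (∀ i, S.right (F k i) = F k (i + 1)) → ∀ i, S.TopRegular (F (k + 1) i) →
      S.right (F (k + 1) i) = F (k + 1) (i + 1) ∧ S.TopRegular (F (k + 1) (i + 1)) := by
    intro k hk i hi
    have h2 : S.right (F (k + 1) i) = F (k + 1) (i + 1) := by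
      apply S.up.injective
      rw [hi.up_right, hup, hup, hk]
    refine ⟨h2, ?_⟩
    rw [← h2]
    exact hi.of_sameCycle ⟨1, rfl⟩
  have hall : ∀ k, (∀ i, S.right (F k i) = F k (i + 1)) → ∀ i, S.TopRegular (F (k + 1) i) →
      ∀ j, S.TopRegular (F (k + 1) j) := by
    intro k hk i hi j
    have h2 : ∀ t : ℕ, S.TopRegular (F (k + 1) (i + t)) := by
      intro t
      induction t with
      | zero => simpa using hi
      | succ t ih =>
        push_cast
        rw [← add_assoc]
        exact (hstep k hk _ ih).2
    obtain ⟨t, ht⟩ := ZMod.natCast_zmod_surjective (j - i)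
    have := h2 t
    rwa [ht, add_sub_cancel] at this
  -- The height is the first positive depth at which a zero appears on the upper boundary again; it
  -- exists because the powers of `up⁻¹` return to row `0`.
  have hex : ∃ h, 0 < h ∧ ¬ S.TopRegular (F h 0) := by
    refine ⟨orderOf S.up⁻¹, orderOf_pos _, ?_⟩
    simp only [hF, pow_orderOf_eq_one, Equiv.Perm.one_apply]
    exact hnot0 0
  classical
  obtain ⟨hh0, hhn⟩ := Nat.find_spec hex
  have hmin : ∀ k, 0 < k → k < Nat.find hex → S.TopRegular (F k 0) := by
    intro k hk0 hk
    by_contra hne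
    exact Nat.find_min hex hk ⟨hk0, hne⟩
  set h := Nat.find hex
  have hright : ∀ k < h, ∀ i, S.right (F k i) = F k (i + 1) := by
    intro k
    induction k with
    | zero => exact fun _ i => (hf1 i).symm
    | succ k ih =>
      intro hk i
      have hk' := ih (by omega)
      exact (hstep k hk' i (hall k hk' 0 (hmin _ (by omega) hk) i)).1
  have htop : ∀ k, 0 < k → k < h → ∀ i, S.TopRegular (F k i) := by
    intro k hk0 hk i
    obtain ⟨k, rfl⟩ := Nat.exists_eq_succ_of_ne_zero hk0.ne'
    exact hall k (hright k (by omega)) 0 (hmin _ hk0 hk) i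
  have hnoth : ∀ i, ¬ S.TopRegular (F h i) := by
    intro i hi
    obtain ⟨k, hk⟩ := Nat.exists_eq_succ_of_ne_zero hh0.ne'
    rw [hk] at hi hhn
    exact hhn (hall k (hright k (by omega)) i hi 0)
  have hinj : ∀ k i l j, k ≤ l → l < h → F k i = F l j → k = l ∧ i = j := by
    intro k i l j hkl hl heq
    -- If two distinct rows met, shifting up by `k` would identify a square of row `0` with one in a
    -- row whose top is regular.
    have h2 : F 0 i = F (l - k) j := by
      apply (S.up⁻¹ ^ k).injective
      change F k i = _
      rw [heq]
      simp only [hF]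
      rw [← Equiv.Perm.mul_apply, ← pow_add, Nat.add_sub_cancel' hkl]
    have h3 : k = l := by
      by_contra hne
      apply hnot0 i
      rw [h2]
      exact htop _ (by omega) (by omega) j
    subst h3
    rw [Nat.sub_self] at h2
    exact ⟨rfl, hf h2⟩
  have hsurj : ∀ y, ∃ k, k < h ∧ ∃ i, F k i = y := by
    -- Adjacency inside the cylinder cannot leave the rectangle: neither the top of row `0` nor the
    -- top of row `h` is regular. As there is one cylinder, the rectangle is everything.
    have hclosed : ∀ x y, S.CylinderStep x y →
        ((∃ k, k < h ∧ ∃ i, F k i = x) ↔ ∃ k, k < h ∧ ∃ i, F k i = y) := by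
      rintro x y (rfl | ⟨rfl, hx⟩)
      · constructor
        · rintro ⟨k, hk, i, rfl⟩
          exact ⟨k, hk, i + 1, (hright k hk i).symm⟩
        · rintro ⟨k, hk, i, hi⟩
          refine ⟨k, hk, i - 1, ?_⟩
          apply S.right.injective
          rw [hright k hk, sub_add_cancel, hi]
      · constructor
        · rintro ⟨k, hk, i, rfl⟩
          obtain _ | k := k
          · exact absurd hx (hnot0 i)
          · exact ⟨k, by omega, i, (hup k i).symm⟩
        · rintro ⟨k, hk, i, hi⟩
          rw [← hup] at hi
          have hi' := S.up.injective hi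
          refine ⟨k + 1, ?_, i, hi'⟩
          by_contra hne
          have hkh : k + 1 = h := by omega
          rw [hkh] at hi'
          exact hnoth i (hi' ▸ hx)
    intro y
    have key : ∀ x y, Relation.EqvGen S.CylinderStep x y →
        ((∃ k, k < h ∧ ∃ i, F k i = x) ↔ ∃ k, k < h ∧ ∃ i, F k i = y) := by
      intro x y hxy
      induction hxy with
      | rel x y hxy => exact hclosed x y hxy
      | refl x => exact Iff.rfl
      | symm x y _ ih => exact ih.symm
      | trans x y z _ _ ih1 ih2 => exact ih1.trans ih2
    exact (key x₀ y (h1 _ _)).1 ⟨0, hh0, 0, hf0⟩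
  have hh : NeZero h := ⟨hh0.ne'⟩
  let E : ZMod h × ZMod w → Fin N := fun p => F p.1.val p.2
  have hE : Function.Bijective E := by
    constructor
    · rintro ⟨k, i⟩ ⟨l, j⟩ heq
      rcases le_total k.val l.val with hkl | hkl
      · obtain ⟨h2, rfl⟩ := hinj _ _ _ _ hkl (ZMod.val_lt l) heq
        rw [ZMod.val_injective h h2]
      · obtain ⟨h2, rfl⟩ := hinj _ _ _ _ hkl (ZMod.val_lt k) heq.symm
        rw [ZMod.val_injective h h2]
    · intro y
      obtain ⟨k, hk, i, hi⟩ := hsurj y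
      refine ⟨((k : ZMod h), i), ?_⟩
      change F (k : ZMod h).val i = y
      rw [ZMod.val_cast_of_lt hk, hi]
  refine ⟨h, w, hh, hw', Equiv.ofBijective E hE, fun k i => hright _ (ZMod.val_lt k) i, ?_, ?_⟩
  · intro k i hk
    have h2 : k.val = (k - 1).val + 1 := by
      have h3 : 0 < k.val := Nat.pos_of_ne_zero fun h0 => hk ((ZMod.val_eq_zero k).1 h0)
      have h4 : (k.val - 1 : ℕ) < h := (Nat.sub_le _ _).trans_lt (ZMod.val_lt k)
      have h5 : ((k.val - 1 : ℕ) : ZMod h) = k - 1 := by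
        rw [Nat.cast_sub h3, ZMod.natCast_zmod_val, Nat.cast_one]
      rw [← h5, ZMod.val_cast_of_lt h4]
      omega
    change S.up (F k.val i) = F (k - 1).val i
    rw [h2, hup]
  · intro k i hk
    have h3 : 0 < k.val := Nat.pos_of_ne_zero fun h0 => hk ((ZMod.val_eq_zero k).1 h0)
    exact htop _ h3 (ZMod.val_lt k) i _ (Equiv.Perm.SameCycle.refl _ _)

end SquareTiledSurface

/-! ### The rectangular model of a one-cylinder surface -/

section Rectangle

variable {r : ℕ} {m : Fin r → ℕ} {h w : ℕ}

/-- The right neighbours in a rectangle of height `h` whose vertical sides are identified. -/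
def rectRight (h w : ℕ) : Equiv.Perm (ZMod h × ZMod w) :=
  Equiv.prodCongr (Equiv.refl _) (Equiv.addRight 1)

/-- The top neighbours in a rectangle with rows numbered from top to bottom, whose top side is glued
to the bottom side by `π`. -/
def rectUp (h : ℕ) (π : Equiv.Perm (ZMod w)) : Equiv.Perm (ZMod h × ZMod w) :=
  (Equiv.prodCongrRight fun k => if k = 0 then π else 1).trans
    (Equiv.prodCongr (Equiv.subRight 1) (Equiv.refl _))

/-- The labelling of the upper right corners in a rectangle with labels on the top side only. -/
def rectZero (h : ℕ) (ℓ : ZMod w → Option (Fin r)) (p : ZMod h × ZMod w) : Option (Fin r) :=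
  if p.1 = 0 then ℓ p.2 else none

theorem rectRight_apply (k : ZMod h) (i : ZMod w) : rectRight h w (k, i) = (k, i + 1) := rfl

theorem rectUp_zero (π : Equiv.Perm (ZMod w)) (i : ZMod w) : rectUp h π (0, i) = (-1, π i) := by
  simp [rectUp]

theorem rectUp_of_ne (π : Equiv.Perm (ZMod w)) {k : ZMod h} (hk : k ≠ 0) (i : ZMod w) :
    rectUp h π (k, i) = (k - 1, i) := by
  simp [rectUp, hk]

theorem rectZero_zero (ℓ : ZMod w → Option (Fin r)) (i : ZMod w) : rectZero h ℓ (0, i) = ℓ i :=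
  if_pos rfl

theorem rectZero_of_ne (ℓ : ZMod w → Option (Fin r)) {p : ZMod h × ZMod w} (hp : p.1 ≠ 0) :
    rectZero h ℓ p = none :=
  if_neg hp

/-- The permutation of the corners of a rectangle describing its vertices. -/
def rectVertex (h : ℕ) (π : Equiv.Perm (ZMod w)) : Equiv.Perm (ZMod h × ZMod w) :=
  (rectUp h π)⁻¹ * (rectRight h w)⁻¹ * rectUp h π * rectRight h w

theorem rectVertex_zero (π : Equiv.Perm (ZMod w)) (i : ZMod w) :
    rectVertex h π (0, i) = (0, vertexPerm π i) := by
  simp only [rectVertex, Equiv.Perm.mul_apply]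
  rw [Equiv.Perm.inv_eq_iff_eq, Equiv.Perm.inv_eq_iff_eq, rectRight_apply, rectUp_zero, rectUp_zero,
    rectRight_apply]
  simp [vertexPerm]

theorem rectVertex_of_ne (π : Equiv.Perm (ZMod w)) {k : ZMod h} (hk : k ≠ 0) (i : ZMod w) :
    rectVertex h π (k, i) = (k, i) := by
  simp only [rectVertex, Equiv.Perm.mul_apply]
  rw [Equiv.Perm.inv_eq_iff_eq, Equiv.Perm.inv_eq_iff_eq, rectRight_apply, rectUp_of_ne _ hk,
    rectUp_of_ne _ hk, rectRight_apply]

theorem sameCycle_rectVertex (π : Equiv.Perm (ZMod w)) (i : ZMod w) (q : ZMod h × ZMod w) :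
    (rectVertex h π).SameCycle (0, i) q ↔ q.1 = 0 ∧ (vertexPerm π).SameCycle i q.2 := by
  constructor
  · intro hq
    constructor
    · have := Equiv.Perm.SameCycle.map_of_forall (σ := 1) (p := Prod.fst) (fun z => ?_) hq
      · rw [Equiv.Perm.sameCycle_one] at this
        exact this.symm
      · rw [Equiv.Perm.sameCycle_one]
        obtain ⟨k, i⟩ := z
        rcases eq_or_ne k 0 with rfl | hk
        · rw [rectVertex_zero]
        · rw [rectVertex_of_ne _ hk]
    · refine Equiv.Perm.SameCycle.map_of_forall (p := Prod.snd) (fun z => ?_) hq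
      obtain ⟨k, i⟩ := z
      rcases eq_or_ne k 0 with rfl | hk
      · rw [rectVertex_zero]
        exact ⟨1, rfl⟩
      · rw [rectVertex_of_ne _ hk]
  · obtain ⟨k, j⟩ := q
    rintro ⟨rfl, hs⟩
    exact Equiv.Perm.SameCycle.map_of_forall (p := fun i => ((0 : ZMod h), i))
      (fun z => ⟨1, rectVertex_zero π z⟩) hs

theorem isLabelling_rect_iff {π : Equiv.Perm (ZMod w)} {ℓ : ZMod w → Option (Fin r)} :
    IsLabelling m (rectVertex h π) (rectZero h ℓ) ↔ IsLabelling m (vertexPerm π) ℓ := by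
  have hsome : ∀ q : ZMod h × ZMod w, ∀ i, rectZero h ℓ q = some i ↔ q.1 = 0 ∧ ℓ q.2 = some i := by
    intro q i
    by_cases hq : q.1 = 0 <;> simp [rectZero, hq]
  have hcard : ∀ i, Nat.card {q : ZMod h × ZMod w // rectZero h ℓ q = some i} =
      Nat.card {x // ℓ x = some i} := by
    intro i
    refine Nat.card_congr
      { toFun := fun q => ⟨q.1.2, ((hsome _ _).1 q.2).2⟩
        invFun := fun x => ⟨(0, x.1), (hsome _ _).2 ⟨rfl, x.2⟩⟩
        left_inv := ?_
        right_inv := fun _ => rfl }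
    rintro ⟨⟨k, x⟩, hx⟩
    obtain ⟨rfl, h2⟩ := (hsome _ _).1 hx
    rfl
  constructor
  · intro H
    refine ⟨fun x y i hx => ?_, fun i => (hcard i).symm.trans (H.card i), fun x hx => ?_⟩
    · have := H.eq_iff (0, x) (0, y) i (by rw [rectZero_zero, hx])
      rw [sameCycle_rectVertex, rectZero_zero] at this
      simpa using this
    · have := H.regular (0, x) (by rw [rectZero_zero, hx])
      rw [rectVertex_zero] at this
      exact (Prod.ext_iff.1 this).2
  · intro H
    refine ⟨?_, fun i => (hcard i).trans (H.card i), ?_⟩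
    · rintro ⟨k, x⟩ y i hx
      obtain ⟨h1, h2⟩ := (hsome _ _).1 hx
      change k = 0 at h1
      subst h1
      rw [sameCycle_rectVertex, hsome, H.eq_iff x y.2 i h2]
    · rintro ⟨k, x⟩ hx
      rcases eq_or_ne k 0 with rfl | hk
      · rw [rectZero_zero] at hx
        rw [rectVertex_zero, H.regular x hx]
      · exact rectVertex_of_ne _ hk x

theorem zmod_induction_of_ne_zero {h : ℕ} [NeZero h] {P : ZMod h → Prop} (h0 : P 0)
    (hs : ∀ k, k ≠ 0 → P (k - 1) → P k) (k : ZMod h) : P k := by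
  have key : ∀ t : ℕ, t < h → P (t : ZMod h) := by
    intro t
    induction t with
    | zero => exact fun _ => by simpa using h0
    | succ t ih =>
      intro ht
      refine hs _ ?_ ?_
      · rw [Ne, ZMod.natCast_eq_zero_iff]
        exact Nat.not_dvd_of_pos_of_lt (Nat.succ_pos t) ht
      · simpa using ih (by omega)
  have := key k.val (ZMod.val_lt k)
  rwa [ZMod.natCast_zmod_val] at this

theorem rect_rel_all [NeZero h] [NeZero w] {P : ZMod h × ZMod w → ZMod h × ZMod w → Prop}
    (he : Equivalence P) (h1 : ∀ k i, P (k, i) (k, i + 1))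
    (h2 : ∀ k i, k ≠ 0 → P (k, i) (k - 1, i)) (x y : ZMod h × ZMod w) : P x y := by
  have hrow : ∀ i, P (0, i) (0, 0) := by
    intro i
    obtain ⟨t, rfl⟩ := ZMod.natCast_zmod_surjective i
    induction t with
    | zero => simpa using he.refl _
    | succ t ih =>
      push_cast
      exact he.trans (he.symm (h1 _ _)) ih
  have key : ∀ x, P x (0, 0) := by
    rintro ⟨k, i⟩
    induction k using zmod_induction_of_ne_zero with
    | h0 => exact hrow i
    | hs k hk ih => exact he.trans (h2 k i hk) ih
  exact he.trans (key x) (he.symm (key y))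

theorem rect_connected [NeZero h] [NeZero w] (π : Equiv.Perm (ZMod w)) (x y : ZMod h × ZMod w) :
    ∃ σ ∈ Subgroup.closure {rectRight h w, rectUp h π}, σ x = y := by
  refine rect_rel_all (P := fun x y => ∃ σ ∈ Subgroup.closure {rectRight h w, rectUp h π}, σ x = y)
    ⟨fun x => ⟨1, one_mem _, rfl⟩, ?_, ?_⟩ ?_ ?_ x y
  · rintro x _ ⟨σ, hσ, rfl⟩
    exact ⟨σ⁻¹, inv_mem hσ, by simp⟩
  · rintro x _ _ ⟨σ, hσ, rfl⟩ ⟨τ, hτ, rfl⟩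
    exact ⟨τ * σ, mul_mem hτ hσ, rfl⟩
  · exact fun k i => ⟨_, Subgroup.subset_closure (Set.mem_insert _ _), rfl⟩
  · exact fun k i hk => ⟨_, Subgroup.subset_closure (Set.mem_insert_of_mem _ rfl),
      rectUp_of_ne π hk i⟩

/-- The rows other than `0` already fill all rows other than `-1`, so injectivity sends row `0`, the
top one, to the bottom row `-1`. -/
theorem exists_eq_rectUp {u : Equiv.Perm (ZMod h × ZMod w)} [NeZero w]
    (hu : ∀ k i, k ≠ 0 → u (k, i) = (k - 1, i)) : ∃ π, u = rectUp h π := by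
  have h0 : ∀ i, (u (0, i)).1 = -1 := by
    intro i
    by_contra hne
    have h1 : (u (0, i)).1 + 1 ≠ 0 := fun h2 => hne (eq_neg_of_add_eq_zero_left h2)
    have h2 := hu _ (u (0, i)).2 h1
    rw [add_sub_cancel_right] at h2
    have h3 := u.injective h2
    exact h1 (Prod.ext_iff.1 h3).1
  have hinj : Function.Injective fun i => (u (0, i)).2 := by
    intro i j hij
    have := u.injective (Prod.ext ((h0 i).trans (h0 j).symm) hij)
    exact (Prod.ext_iff.1 this).2
  refine ⟨Equiv.ofBijective _ (Finite.injective_iff_bijective.1 hinj), Equiv.ext ?_⟩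
  rintro ⟨k, i⟩
  rcases eq_or_ne k 0 with rfl | hk
  · rw [rectUp_zero]
    exact Prod.ext (h0 i) rfl
  · rw [rectUp_of_ne _ hk, hu k i hk]

/-! ### Classification of one-cylinder surfaces by width and gluing -/

/-- An identification of the squares of a rectangle with `Fin N`. -/
noncomputable def rectEquiv {N : ℕ} (hw : w ∈ N.divisors) : ZMod (N / w) × ZMod w ≃ Fin N :=
  have : NeZero w := ⟨(Nat.pos_of_mem_divisors hw).ne'⟩
  have : NeZero (N / w) := ⟨(Nat.div_pos (Nat.divisor_le hw) (Nat.pos_of_mem_divisors hw)).ne'⟩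
  Finite.equivFinOfCardEq (by
    rw [Nat.card_prod, Nat.card_zmod, Nat.card_zmod,
      Nat.div_mul_cancel (Nat.dvd_of_mem_divisors hw)])

/-- The one-cylinder surface of width `w`, tiled with `N` squares, with a given gluing of the top
of the cylinder to its bottom. -/
noncomputable def rectSurface {N : ℕ} (hw : w ∈ N.divisors) (p : Gluing m w) :
    SquareTiledSurface m N :=
  have : NeZero w := ⟨(Nat.pos_of_mem_divisors hw).ne'⟩
  have : NeZero (N / w) := ⟨(Nat.div_pos (Nat.divisor_le hw) (Nat.pos_of_mem_divisors hw)).ne'⟩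
  SquareTiledSurface.ofEquiv (rectEquiv hw) (rectRight (N / w) w) (rectUp (N / w) p.1.1)
    (rectZero (N / w) p.1.2) (rect_connected p.1.1) (isLabelling_rect_iff.2 p.2)

theorem numCylinders_rectSurface {N : ℕ} (hw : w ∈ N.divisors) (p : Gluing m w) :
    (rectSurface hw p).numCylinders = 1 := by
  have h1 : NeZero w := ⟨(Nat.pos_of_mem_divisors hw).ne'⟩
  have h2 : NeZero (N / w) := ⟨(Nat.div_pos (Nat.divisor_le hw) (Nat.pos_of_mem_divisors hw)).ne'⟩
  rw [SquareTiledSurface.numCylinders_eq_one_iff (Nat.pos_of_ne_zero (Nat.mem_divisors.1 hw).2)]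
  set S := rectSurface hw p
  set e := rectEquiv hw
  have hR : ∀ x, S.right (e x) = e (rectRight _ _ x) := fun x => by
    change e.permCongr _ (e x) = _
    simp
  have hU : ∀ x, S.up (e x) = e (rectUp _ p.1.1 x) := fun x => by
    change e.permCongr _ (e x) = _
    simp
  have hZ : ∀ x, S.zero (e x) = rectZero _ p.1.2 x := fun x => by
    change rectZero _ p.1.2 (e.symm (e x)) = _
    rw [Equiv.symm_apply_apply]
  have key := rect_rel_all (P := fun x y => Relation.EqvGen S.CylinderStep (e x) (e y))
    ⟨fun _ => Relation.EqvGen.refl _, Relation.EqvGen.symm _ _, Relation.EqvGen.trans _ _ _⟩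
    (fun k i => Relation.EqvGen.rel _ _ (Or.inl ?_))
    (fun k i hk => Relation.EqvGen.rel _ _ (Or.inr ⟨?_, ?_⟩))
  · intro x y
    simpa using key (e.symm x) (e.symm y)
  · rw [hR, rectRight_apply]
  · rw [hU, rectUp_of_ne _ hk]
  · intro y hy
    obtain ⟨y, rfl⟩ := e.surjective y
    have h3 := Equiv.Perm.SameCycle.map_of_forall (σ := 1) (p := fun z => (e.symm z).1)
      (fun z => ?_) hy
    · rw [Equiv.Perm.sameCycle_one, Equiv.symm_apply_apply, Equiv.symm_apply_apply] at h3
      rw [hZ, rectZero_of_ne]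
      rwa [← h3]
    · obtain ⟨z, rfl⟩ := e.surjective z
      rw [hR, Equiv.Perm.sameCycle_one, Equiv.symm_apply_apply, Equiv.symm_apply_apply]
      rfl

theorem exists_iso_rectSurface {N : ℕ} (hN : 0 < N) (i₀ : Fin r) (S : SquareTiledSurface m N)
    (hS : S.numCylinders = 1) : ∃ (w : ℕ) (hw : w ∈ N.divisors) (p : Gluing m w),
      SquareTiledSurface.Iso (rectSurface hw p) S := by
  obtain ⟨h, w, hh, hw, E, h1, h2, h3⟩ :=
    S.exists_rectangle ((SquareTiledSurface.numCylinders_eq_one_iff hN).1 hS) i₀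
  have hcard : h * w = N := by
    have := Nat.card_congr E
    rwa [Nat.card_prod, Nat.card_zmod, Nat.card_zmod, Nat.card_fin] at this
  have hwd : w ∈ N.divisors := Nat.mem_divisors.2 ⟨⟨h, by rw [← hcard, mul_comm]⟩, hN.ne'⟩
  obtain rfl : h = N / w := (Nat.div_eq_of_eq_mul_left (NeZero.pos w) hcard.symm).symm
  obtain ⟨π, hπ⟩ := exists_eq_rectUp (u := E.symm.permCongr S.up) (fun k i hk => by
    rw [Equiv.permCongr_apply, Equiv.symm_symm, h2 k i hk, Equiv.symm_apply_apply])
  have hU : ∀ x, E (rectUp _ π x) = S.up (E x) := by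
    intro x
    rw [← hπ]
    simp
  have hR : ∀ x, E (rectRight _ w x) = S.right (E x) := fun x => (h1 x.1 x.2).symm
  have hZ : ∀ x, S.zero (E x) = rectZero _ (fun i => S.zero (E (0, i))) x := by
    rintro ⟨k, i⟩
    rcases eq_or_ne k 0 with rfl | hk
    · rw [rectZero_zero]
    · rw [rectZero_of_ne _ hk, h3 k i hk]
  have hl : IsLabelling m (vertexPerm π) fun i => S.zero (E (0, i)) := by
    rw [← isLabelling_rect_iff (h := N / w)]
    have h4 := S.isLabelling.permCongr E.symm
    rw [Equiv.permCongr_commutator, hπ] at h4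
    have h5 : E.symm.permCongr S.right = rectRight (N / w) w := by
      ext1 x
      rw [Equiv.permCongr_apply, Equiv.symm_symm, ← hR, Equiv.symm_apply_apply]
    rw [h5] at h4
    have h6 : S.zero ∘ E.symm.symm = rectZero _ fun i => S.zero (E (0, i)) := funext hZ
    rwa [h6] at h4
  refine ⟨w, hwd, ⟨(π, _), hl⟩,
    S.iso_ofEquiv_of_forall (rect_connected π) (isLabelling_rect_iff.2 hl) E
      fun x => ⟨hR x, hU x, hZ x⟩⟩

theorem iso_rectSurface_iff {N w' : ℕ} {hw : w ∈ N.divisors} {hw' : w' ∈ N.divisors}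
    {p : Gluing m w} {p' : Gluing m w'} :
    SquareTiledSurface.Iso (rectSurface hw p) (rectSurface hw' p') ↔
      ∃ E : ZMod (N / w) × ZMod w ≃ ZMod (N / w') × ZMod w', ∀ x,
        E (rectRight _ _ x) = rectRight _ _ (E x) ∧ E (rectUp _ p.1.1 x) = rectUp _ p'.1.1 (E x) ∧
        rectZero _ p'.1.2 (E x) = rectZero _ p.1.2 x :=
  have : NeZero w := ⟨(Nat.pos_of_mem_divisors hw).ne'⟩
  have : NeZero (N / w) := ⟨(Nat.div_pos (Nat.divisor_le hw) (Nat.pos_of_mem_divisors hw)).ne'⟩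
  have : NeZero w' := ⟨(Nat.pos_of_mem_divisors hw').ne'⟩
  have : NeZero (N / w') := ⟨(Nat.div_pos (Nat.divisor_le hw') (Nat.pos_of_mem_divisors hw')).ne'⟩
  SquareTiledSurface.iso_ofEquiv (hc := rect_connected p.1.1) (hl := isLabelling_rect_iff.2 p.2)
    (hc' := rect_connected p'.1.1) (hl' := isLabelling_rect_iff.2 p'.2)

theorem iso_rectSurface_vadd {N : ℕ} (hw : w ∈ N.divisors) (p : Gluing m w) (s : ZMod w) :
    SquareTiledSurface.Iso (rectSurface hw p) (rectSurface hw (s +ᵥ p)) := by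
  refine iso_rectSurface_iff.2
    ⟨Equiv.prodCongr (Equiv.refl _) (Equiv.addRight s), ?_⟩
  rintro ⟨k, i⟩
  change (k, i + 1 + s) = (k, i + s + 1) ∧ Equiv.prodCongr (Equiv.refl _) (Equiv.addRight s) _ =
    rectUp _ _ (k, i + s) ∧ rectZero _ _ (k, i + s) = _
  refine ⟨by ring_nf, ?_⟩
  rcases eq_or_ne k 0 with rfl | hk
  · rw [rectUp_zero, rectUp_zero, vadd_gluing_fst, rectZero_zero, rectZero_zero, vadd_gluing_snd]
    exact ⟨rfl, rfl⟩
  · rw [rectUp_of_ne _ hk, rectUp_of_ne _ hk, rectZero_of_ne _ hk, rectZero_of_ne _ hk]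
    exact ⟨rfl, rfl⟩

/-- The width is the length of the cycles of `right`, which an isomorphism preserves. -/
theorem eq_width_of_iso_rectSurface {N : ℕ} {w' : ℕ} {hw : w ∈ N.divisors}
    {hw' : w' ∈ N.divisors} {p : Gluing m w} {p' : Gluing m w'}
    (H : SquareTiledSurface.Iso (rectSurface hw p) (rectSurface hw' p')) : w = w' := by
  obtain ⟨E, hE⟩ := iso_rectSurface_iff.1 H
  have h1 : ∀ t : ℕ, E (0, t) = ((E (0, 0)).1, (E (0, 0)).2 + t) := by
    intro t
    induction t with
    | zero => simp
    | succ t ih =>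
      have := (hE (0, t)).1
      rw [rectRight_apply, ih, rectRight_apply] at this
      push_cast
      rw [this, add_assoc]
  have h2 : ∀ t : ℕ, (t : ZMod w) = 0 ↔ (t : ZMod w') = 0 := by
    intro t
    constructor
    · intro h
      have := h1 t
      rw [h] at this
      simpa using (Prod.ext_iff.1 this).2
    · intro h
      have := h1 t
      rw [h, add_zero] at this
      exact (Prod.ext_iff.1 (E.injective this)).2
  simp only [ZMod.natCast_eq_zero_iff] at h2
  exact Nat.dvd_antisymm ((h2 w').2 dvd_rfl) ((h2 w).1 dvd_rfl)

/-- An isomorphism commutes with `right`, so it is a translation on the top row; commuting with `up`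
propagates the same translation to all rows. -/
theorem exists_vadd_of_iso_rectSurface {N : ℕ} (i₀ : Fin r) {hw : w ∈ N.divisors}
    {p p' : Gluing m w} (H : SquareTiledSurface.Iso (rectSurface hw p) (rectSurface hw p')) :
    ∃ s : ZMod w, s +ᵥ p = p' := by
  have hw1 : NeZero w := ⟨(Nat.pos_of_mem_divisors hw).ne'⟩
  have hh1 : NeZero (N / w) :=
    ⟨(Nat.div_pos (Nat.divisor_le hw) (Nat.pos_of_mem_divisors hw)).ne'⟩
  obtain ⟨E, hE⟩ := iso_rectSurface_iff.1 H
  obtain ⟨a, ha⟩ : ∃ a, p.1.2 a = some i₀ := by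
    have : 0 < Nat.card {x // p.1.2 x = some i₀} := by
      rw [p.2.card]
      omega
    obtain ⟨x, hx⟩ := (Nat.card_pos_iff.1 this).1
    exact ⟨x, hx⟩
  have hrow : ∀ t : ℕ, E (0, a + t) = ((E (0, a)).1, (E (0, a)).2 + t) := by
    intro t
    induction t with
    | zero => simp
    | succ t ih =>
      have := (hE (0, a + t)).1
      rw [rectRight_apply, ih, rectRight_apply] at this
      push_cast
      rw [← add_assoc, this, add_assoc]
  -- Labels occur in row `0` only, so a labelled corner pins the image row.
  have hE0 : (E (0, a)).1 = 0 := by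
    by_contra hne
    have := (hE (0, a)).2.2
    rw [rectZero_of_ne _ hne, rectZero_zero, ha] at this
    simp at this
  set s := (E (0, a)).2 - a with hs
  have h0 : ∀ i, E (0, i) = (0, i + s) := by
    intro i
    obtain ⟨t, ht⟩ := ZMod.natCast_zmod_surjective (i - a)
    have := hrow t
    rw [ht, add_sub_cancel, hE0] at this
    rw [this, hs]
    congr 1
    ring
  have hall : ∀ k i, E (k, i) = (k, i + s) := by
    intro k i
    induction k using zmod_induction_of_ne_zero with
    | h0 => exact h0 i
    | hs k hk ih =>
      apply (rectUp (N / w) p'.1.1).injective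
      have := (hE (k, i)).2.1
      rw [rectUp_of_ne _ hk] at this
      rw [← this, ih, rectUp_of_ne _ hk]
  refine ⟨s, Subtype.ext (Prod.ext (Equiv.ext fun i => ?_) (funext fun i => ?_))⟩
  · obtain ⟨i, rfl⟩ : ∃ j, j + s = i := ⟨i - s, sub_add_cancel _ _⟩
    have := (hE (0, i)).2.1
    rw [rectUp_zero, hall, hall, rectUp_zero] at this
    rw [vadd_gluing_fst]
    exact (Prod.ext_iff.1 this).2
  · obtain ⟨i, rfl⟩ : ∃ j, j + s = i := ⟨i - s, sub_add_cancel _ _⟩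
    have := (hE (0, i)).2.2
    rw [h0, rectZero_zero, rectZero_zero] at this
    rw [vadd_gluing_snd, this]

/-- The height is `N / w`, so the width and the rotation class of the gluing are complete,
independent invariants. The label `i₀` is what marks the top row. -/
theorem numSquareTiled_one_eq (m : Fin r → ℕ) (i₀ : Fin r) {N : ℕ} (hN : 0 < N) :
    numSquareTiled m 1 N = ∑ w ∈ N.divisors, numRotationClasses m w := by
  let Q := {q : Quotient (SquareTiledSurface.setoid m N) //
    ∃ S : SquareTiledSurface m N, ⟦S⟧ = q ∧ S.numCylinders = 1}
  let F : (Σ w : N.divisors, AddAction.orbitRel.Quotient (ZMod w) (Gluing m w)) → Q := fun z =>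
    Quotient.liftOn z.2 (fun p => ⟨⟦rectSurface z.1.2 p⟧, _, rfl, numCylinders_rectSurface _ p⟩) (by
      rintro p q ⟨s, rfl⟩
      exact Subtype.ext (Quotient.sound (SquareTiledSurface.Iso.symm (iso_rectSurface_vadd _ q s))))
  have hF : Function.Bijective F := by
    constructor
    · rintro ⟨⟨w, hw⟩, a⟩ ⟨⟨w', hw'⟩, b⟩ hab
      induction a using Quotient.inductionOn with | _ p =>
      induction b using Quotient.inductionOn with | _ p' =>
      have h1 : SquareTiledSurface.Iso (rectSurface hw p) (rectSurface hw' p') :=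
        Quotient.exact (congrArg Subtype.val hab)
      obtain rfl := eq_width_of_iso_rectSurface h1
      obtain ⟨s, rfl⟩ := exists_vadd_of_iso_rectSurface i₀ h1
      have h2 : (Quotient.mk (AddAction.orbitRel (ZMod w) (Gluing m w)) (s +ᵥ p)) =
          Quotient.mk _ p := Quotient.sound ⟨s, rfl⟩
      rw [h2]
    · rintro ⟨_, S, rfl, hS⟩
      obtain ⟨w, hw, p, hp⟩ := exists_iso_rectSurface hN i₀ S hS
      exact ⟨⟨⟨w, hw⟩, ⟦p⟧⟩, Subtype.ext (Quotient.sound hp)⟩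
  have hfin : ∀ w : N.divisors, Finite (AddAction.orbitRel.Quotient (ZMod w) (Gluing m w)) := by
    intro w
    have : NeZero (w : ℕ) := ⟨(Nat.pos_of_mem_divisors w.2).ne'⟩
    exact Quotient.finite _
  rw [numSquareTiled, ← Nat.card_congr (Equiv.ofBijective F hF), Nat.card_sigma,
    ← Finset.sum_coe_sort N.divisors]
  rfl

end Rectangle

/-! ### Asymptotics -/

/-- The hockey-stick identity in falling factorials; it is exact, so the main term sums without
error. -/
theorem sum_Icc_descFactorial {n : ℕ} (hn : 0 < n) (M : ℕ) :
    (n + 1) * ∑ w ∈ Finset.Icc 1 M, w.descFactorial n = (M + 1).descFactorial (n + 1) := by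
  induction M with
  | zero =>
    rw [Nat.descFactorial_of_lt (show 0 + 1 < n + 1 by omega)]
    simp
  | succ M ih =>
    rw [Finset.sum_Icc_succ_top (by omega), mul_add, ih, Nat.succ_descFactorial_succ (M + 1) n,
      Nat.descFactorial_succ]
    rcases le_or_gt n (M + 1) with h | h
    · rw [← add_mul]
      congr 1
      omega
    · simp [Nat.descFactorial_of_lt h]

theorem tendsto_descFactorial_div_pow (n : ℕ) :
    Tendsto (fun x : ℝ => ((⌊x⌋₊ + 1).descFactorial (n + 1) : ℝ) / x ^ (n + 1)) atTop (𝓝 1) := by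
  have hfl : Tendsto (fun x : ℝ => (⌊x⌋₊ : ℝ) / x) atTop (𝓝 1) := tendsto_nat_floor_div_atTop
  have hlim : ∀ c : ℝ, Tendsto (fun x : ℝ => (((⌊x⌋₊ : ℝ) + c) / x) ^ (n + 1)) atTop (𝓝 1) := by
    intro c
    have h1 : Tendsto (fun x : ℝ => (⌊x⌋₊ : ℝ) / x + c / x) atTop (𝓝 (1 + 0)) :=
      hfl.add (tendsto_const_nhds.div_atTop tendsto_id)
    have h2 := h1.pow (n + 1)
    rw [add_zero, one_pow] at h2
    exact h2.congr fun x => by rw [add_div]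
  refine tendsto_of_tendsto_of_tendsto_of_le_of_le' (hlim (1 - n)) (hlim 1) ?_ ?_
  · filter_upwards [eventually_gt_atTop (0 : ℝ),
      (tendsto_nat_floor_atTop (α := ℝ)).eventually_ge_atTop n] with x hx hn
    rw [div_pow]
    gcongr
    have h1 := Nat.pow_sub_le_descFactorial (⌊x⌋₊ + 1) (n + 1)
    have h2 : (⌊x⌋₊ : ℝ) + (1 - n) = ((⌊x⌋₊ + 1 + 1 - (n + 1) : ℕ) : ℝ) := by
      rw [Nat.cast_sub (by omega)]
      push_cast
      ring
    rw [h2]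
    exact_mod_cast h1
  · filter_upwards [eventually_gt_atTop (0 : ℝ)] with x hx
    rw [div_pow]
    gcongr
    exact_mod_cast Nat.descFactorial_le_pow (⌊x⌋₊ + 1) (n + 1)

/-- Writing `N = h * w` and summing over `h` outside: the summatory function of a Dirichlet
convolution with the constant `1`. -/
theorem sum_Icc_sum_divisors (b : ℕ → ℝ) (M : ℕ) :
    ∑ N ∈ Finset.Icc 1 M, ∑ w ∈ N.divisors, b w =
      ∑ h ∈ Finset.Icc 1 M, ∑ w ∈ Finset.Icc 1 (M / h), b w := by
  let g : ArithmeticFunction ℝ := ⟨fun w => if w = 0 then 0 else b w, rfl⟩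
  have hg : ∀ w, w ≠ 0 → g w = b w := fun w hw => if_neg hw
  have h := ArithmeticFunction.sum_Ioc_mul_eq_sum_sum
    (ArithmeticFunction.zeta : ArithmeticFunction ℝ) g M
  have hI : ∀ k, Finset.Ioc 0 k = Finset.Icc 1 k := fun k => rfl
  simp only [hI] at h
  rw [Finset.sum_congr rfl fun N hN => Finset.sum_congr rfl fun w hw =>
    (hg w (Nat.pos_of_mem_divisors hw).ne').symm]
  simp only [ArithmeticFunction.coe_zeta_mul_apply] at h
  rw [h]
  refine Finset.sum_congr rfl fun k hk => ?_
  rw [ArithmeticFunction.natCoe_apply, ArithmeticFunction.zeta_apply_ne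
    (by rw [Finset.mem_Icc] at hk; omega), Nat.cast_one, one_mul]
  exact Finset.sum_congr rfl fun w hw => hg w (by rw [Finset.mem_Icc] at hw; omega)

section Asymptotics

variable {b : ℕ → ℝ} {C K : ℝ} {n : ℕ}

theorem tendsto_sum_Icc_div_pow (hn : 0 < n)
    (h1 : ∀ w, 0 < w → C * w.descFactorial n ≤ b w)
    (h2 : ∀ w, 0 < w → b w ≤ C * w.descFactorial n + K * (w : ℝ) ^ (n - 1)) (hK : 0 ≤ K) :
    Tendsto (fun x : ℝ => (∑ w ∈ Finset.Icc 1 ⌊x⌋₊, b w) / x ^ (n + 1)) atTop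
      (𝓝 (C / (n + 1))) := by
  have hsum : ∀ M : ℕ, ∑ w ∈ Finset.Icc 1 M, C * (w.descFactorial n : ℝ) =
      C / (n + 1) * ((M + 1).descFactorial (n + 1) : ℝ) := by
    intro M
    rw [← sum_Icc_descFactorial hn, ← Finset.mul_sum]
    push_cast
    field_simp
  have hD := (tendsto_descFactorial_div_pow n).const_mul (C / (n + 1))
  rw [mul_one] at hD
  have hE : Tendsto (fun x : ℝ => C / (n + 1) *
      (((⌊x⌋₊ + 1).descFactorial (n + 1) : ℝ) / x ^ (n + 1)) + K / x) atTop
      (𝓝 (C / (n + 1) + 0)) :=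
    hD.add (tendsto_const_nhds.div_atTop tendsto_id)
  rw [add_zero] at hE
  refine tendsto_of_tendsto_of_tendsto_of_le_of_le' hD hE ?_ ?_
  · filter_upwards [eventually_gt_atTop (0 : ℝ)] with x hx
    rw [← mul_div_assoc, ← hsum]
    gcongr with w hw
    exact h1 w (Finset.mem_Icc.1 hw).1
  · filter_upwards [eventually_gt_atTop (0 : ℝ)] with x hx
    have h3 : ∑ w ∈ Finset.Icc 1 ⌊x⌋₊, b w ≤
        C / (n + 1) * ((⌊x⌋₊ + 1).descFactorial (n + 1) : ℝ) + K * x ^ n := by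
      rw [← hsum]
      calc _ ≤ ∑ w ∈ Finset.Icc 1 ⌊x⌋₊, (C * (w.descFactorial n : ℝ) + K * x ^ (n - 1)) := by
            refine Finset.sum_le_sum fun w hw => (h2 w (Finset.mem_Icc.1 hw).1).trans ?_
            have : (w : ℝ) ≤ x := (Nat.cast_le.2 (Finset.mem_Icc.1 hw).2).trans
              (Nat.floor_le hx.le)
            gcongr
        _ = ∑ w ∈ Finset.Icc 1 ⌊x⌋₊, C * (w.descFactorial n : ℝ) +
            ⌊x⌋₊ * (K * x ^ (n - 1)) := by
            rw [Finset.sum_add_distrib, Finset.sum_const, Nat.card_Icc, Nat.add_sub_cancel,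
              nsmul_eq_mul]
        _ ≤ _ := by
            have h4 : (⌊x⌋₊ : ℝ) * (K * x ^ (n - 1)) ≤ x * (K * x ^ (n - 1)) := by
              gcongr
              exact Nat.floor_le hx.le
            have h5 : x * (K * x ^ (n - 1)) = K * x ^ n := by
              rw [mul_left_comm, mul_pow_sub_one hn.ne']
            linarith
    rw [← mul_div_assoc]
    calc _ ≤ _ := div_le_div_of_nonneg_right h3 (by positivity)
      _ = _ := by
        rw [add_div, pow_succ]
        congr 1
        field_simp
-- A bound uniform in `x`, serving as the dominating function when `x = a / h` with varying `h`.
theorem abs_sum_Icc_div_pow_le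
    (h1 : ∀ w, 0 < w → C * w.descFactorial n ≤ b w)
    (h2 : ∀ w, 0 < w → b w ≤ C * w.descFactorial n + K * (w : ℝ) ^ (n - 1)) (hC : 0 ≤ C)
    (hK : 0 ≤ K) (x : ℝ) : |(∑ w ∈ Finset.Icc 1 ⌊x⌋₊, b w) / x ^ (n + 1)| ≤ C + K := by
  rcases le_or_gt x 0 with hx | hx
  · simp [Nat.floor_of_nonpos hx, add_nonneg hC hK]
  have hb : ∀ w, 0 < w → |b w| ≤ (C + K) * (w : ℝ) ^ n := by
    intro w hw
    have hw1 : (1 : ℝ) ≤ w := by exact_mod_cast hw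
    have h3 : (w.descFactorial n : ℝ) ≤ (w : ℝ) ^ n := by
      exact_mod_cast Nat.descFactorial_le_pow w n
    have h4 : (w : ℝ) ^ (n - 1) ≤ (w : ℝ) ^ n := pow_le_pow_right₀ hw1 (Nat.sub_le n 1)
    rw [abs_of_nonneg (le_trans (by positivity) (h1 w hw)), add_mul]
    exact (h2 w hw).trans (by gcongr)
  rw [abs_div, abs_of_pos (pow_pos hx _), div_le_iff₀ (pow_pos hx _)]
  calc |∑ w ∈ Finset.Icc 1 ⌊x⌋₊, b w| ≤ ∑ w ∈ Finset.Icc 1 ⌊x⌋₊, |b w| :=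
        Finset.abs_sum_le_sum_abs _ _
    _ ≤ ∑ w ∈ Finset.Icc 1 ⌊x⌋₊, (C + K) * x ^ n := by
        refine Finset.sum_le_sum fun w hw => (hb w (Finset.mem_Icc.1 hw).1).trans ?_
        have : (w : ℝ) ≤ x := (Nat.cast_le.2 (Finset.mem_Icc.1 hw).2).trans (Nat.floor_le hx.le)
        gcongr
    _ = ⌊x⌋₊ * ((C + K) * x ^ n) := by
        rw [Finset.sum_const, Nat.card_Icc, Nat.add_sub_cancel, nsmul_eq_mul]
    _ ≤ x * ((C + K) * x ^ n) := by
        gcongr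
        exact Nat.floor_le hx.le
    _ = (C + K) * x ^ (n + 1) := by ring

/-- The normalized sum is the series over `h` of `G (a / h) / h ^ (n + 1)`. Each `G (a / h)` tends
to `C / (n + 1)` and is bounded by `C + K`, so dominated convergence produces the zeta series. -/
theorem tendsto_sum_Icc_sum_divisors (hn : 0 < n)
    (h1 : ∀ w, 0 < w → C * w.descFactorial n ≤ b w)
    (h2 : ∀ w, 0 < w → b w ≤ C * w.descFactorial n + K * (w : ℝ) ^ (n - 1)) (hC : 0 ≤ C)
    (hK : 0 ≤ K) :
    Tendsto (fun a : ℝ => 1 / a ^ (n + 1) * ∑ N ∈ Finset.Icc 1 ⌊a⌋₊, ∑ w ∈ N.divisors, b w) atTop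
      (𝓝 (C / (n + 1) * ∑' h : ℕ, 1 / (h : ℝ) ^ (n + 1))) := by
  let G : ℝ → ℝ := fun x => (∑ w ∈ Finset.Icc 1 ⌊x⌋₊, b w) / x ^ (n + 1)
  have key : Tendsto (fun a : ℝ => ∑' h : ℕ, 1 / (h : ℝ) ^ (n + 1) * G (a / h)) atTop
      (𝓝 (∑' h : ℕ, 1 / (h : ℝ) ^ (n + 1) * (C / (n + 1)))) := by
    refine tendsto_tsum_of_dominated_convergence
      (bound := fun h : ℕ => 1 / (h : ℝ) ^ (n + 1) * (C + K))
      ((Real.summable_one_div_nat_pow.2 (by omega)).mul_right _) (fun h => ?_)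
      (Eventually.of_forall fun a h => ?_)
    -- The index `h = 0` contributes nothing, since `1 / 0 ^ (n + 1) = 0`.
    · rcases Nat.eq_zero_or_pos h with rfl | hh
      · simp
      · exact ((tendsto_sum_Icc_div_pow hn h1 h2 hK).comp
          (tendsto_id.atTop_div_const (Nat.cast_pos.2 hh))).const_mul _
    · rw [norm_mul, Real.norm_of_nonneg (by positivity)]
      exact mul_le_mul_of_nonneg_left (abs_sum_Icc_div_pow_le h1 h2 hC hK _) (by positivity)
  rw [tsum_mul_right, mul_comm] at key
  refine key.congr' ?_
  filter_upwards [eventually_gt_atTop (0 : ℝ)] with a ha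
  rw [sum_Icc_sum_divisors, Finset.mul_sum, tsum_eq_sum (s := Finset.Icc 1 ⌊a⌋₊)]
  · refine Finset.sum_congr rfl fun h hh => ?_
    have hh0 : (0 : ℝ) < h := Nat.cast_pos.2 (Finset.mem_Icc.1 hh).1
    simp only [G]
    rw [Nat.floor_div_natCast, div_pow]
    field_simp
  · intro h hh
    rw [Finset.mem_Icc, not_and_or, not_le, not_le, Nat.lt_one_iff] at hh
    rcases hh with rfl | hh
    · simp
    · have : ⌊a / h⌋₊ = 0 := by
        rw [Nat.floor_div_natCast, Nat.div_eq_of_lt hh]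
      simp [G, this]

end Asymptotics

/-! ### Assembling the constants -/

theorem prod_image_zeroMult {r : ℕ} (m : Fin r → ℕ) :
    ∏ k ∈ Finset.univ.image m, 1 / ((k : ℂ) + 1) ^ zeroMult m k =
      1 / ((∏ i, (m i + 1) : ℕ) : ℂ) := by
  have h := Finset.prod_comp (s := Finset.univ) (fun k : ℕ => (k : ℂ) + 1) m
  push_cast
  rw [h, one_div, ← Finset.prod_inv_distrib]
  exact Finset.prod_congr rfl fun k _ => one_div _

/-- The exact number of gluings and the Burnside error `n * (n * w ^ (n - 1) * w)` are divided by
the `w` rotations. -/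
theorem numRotationClasses_bounds {r n : ℕ} {m : Fin r → ℕ} (hr : 0 < r)
    (hn : n = ∑ i, (m i + 1)) (hn0 : 0 < n) {ν : Equiv.Perm (Fin n)}
    (hν : ν.partition.parts = Finset.univ.val.map fun i => m i + 1) {w : ℕ} (hw : 0 < w) :
    (numFactorizations ν / ((∏ i, (m i + 1) : ℕ) * (n - 1).factorial) : ℝ) * w.descFactorial n ≤
        numRotationClasses m w ∧
      (numRotationClasses m w : ℝ) ≤
        (numFactorizations ν / ((∏ i, (m i + 1) : ℕ) * (n - 1).factorial) : ℝ) *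
          w.descFactorial n + (n : ℝ) ^ 2 * (w : ℝ) ^ (n - 1) := by
  have : NeZero w := ⟨hw.ne'⟩
  have hP : (0 : ℝ) < (∏ i, (m i + 1) : ℕ) * (n - 1).factorial := by
    have : 0 < ∏ i, (m i + 1) := Finset.prod_pos fun i _ => Nat.succ_pos _
    positivity
  have hw' : (0 : ℝ) < w := Nat.cast_pos.2 hw
  have hcard : (Nat.card (Gluing m w) : ℝ) =
      (numFactorizations ν / ((∏ i, (m i + 1) : ℕ) * (n - 1).factorial) : ℝ) *
        w.descFactorial n * w := by
    have h := congrArg (Nat.cast : ℕ → ℝ) (card_gluing hn hn0 hν w)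
    push_cast at h hP ⊢
    rw [← eq_div_iff hP.ne'] at h
    rw [h]
    ring
  obtain ⟨h1, h2⟩ := card_gluing_le m w
  replace h2 := h2 ⟨0, hr⟩
  rw [← hn] at h2
  constructor
  · refine le_of_mul_le_mul_right ?_ hw'
    rw [← hcard]
    exact_mod_cast h1
  · refine le_of_mul_le_mul_right ?_ hw'
    rw [add_mul, ← hcard]
    have h3 : (numRotationClasses m w * w : ℝ) ≤
        Nat.card (Gluing m w) + n * (n * w ^ (n - 1) * w) := by exact_mod_cast h2
    linarith

theorem theorem2p3 (g r : ℕ) (hr : 0 < r) (m : Fin r → ℕ) (hg : (∑ i, m i) + 2 = 2 * g)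
    (n : ℕ) (hn : n = ∑ i, (m i + 1)) (ν : Equiv.Perm (Fin n))
    (hν : ν.partition.parts = Finset.univ.val.map fun i => m i + 1) :
    n + 1 = stratumDim g r ∧
    ∃ c₁ : ℝ, IsCylinderContribution g m 1 c₁ ∧
      (c₁ : ℂ) = 2 / (n.factorial : ℂ) *
        (∏ k ∈ Finset.univ.image m, 1 / ((k : ℂ) + 1) ^ zeroMult m k) *
        (∑ j ∈ Finset.range n,
          (j.factorial : ℂ) * ((n - 1 - j).factorial : ℂ) * extChar n j ν) *
        riemannZeta ((n : ℂ) + 1) := by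
  have hnr : n = (∑ i, m i) + r := by simp [hn, Finset.sum_add_distrib]
  have hn0 : 0 < n := by omega
  have hd : n + 1 = stratumDim g r := by
    rw [stratumDim]
    omega
  set C : ℝ := numFactorizations ν / ((∏ i, (m i + 1) : ℕ) * (n - 1).factorial) with hC
  -- The factor `2d = 2 (n + 1)` cancels the `n + 1` from the summation over widths, leaving `2 C
  -- ζ(n + 1)`.
  refine ⟨hd, 2 * (n + 1) * (C / (n + 1) * ∑' h : ℕ, 1 / (h : ℝ) ^ (n + 1)), ?_, ?_⟩
  · have hlim := tendsto_sum_Icc_sum_divisors (b := fun w => (numRotationClasses m w : ℝ)) hn0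
      (fun w hw => (numRotationClasses_bounds hr hn hn0 hν hw).1)
      (fun w hw => (numRotationClasses_bounds hr hn hn0 hν hw).2) (by positivity) (by positivity)
    rw [IsCylinderContribution, ← hd]
    convert hlim.const_mul (2 * ((n : ℝ) + 1)) using 2 with a
    · have hsum : ∑ N ∈ Finset.Icc 1 ⌊a⌋₊, numSquareTiled m 1 N =
          ∑ N ∈ Finset.Icc 1 ⌊a⌋₊, ∑ w ∈ N.divisors, numRotationClasses m w :=
        Finset.sum_congr rfl fun N hN =>
          numSquareTiled_one_eq m ⟨0, hr⟩ (Finset.mem_Icc.1 hN).1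
      rw [hsum]
      push_cast
      rfl
  · have hzeta : riemannZeta ((n : ℂ) + 1) = ((∑' h : ℕ, 1 / (h : ℝ) ^ (n + 1) : ℝ) : ℂ) := by
      have h := zeta_nat_eq_tsum_of_gt_one (show 1 < n + 1 by omega)
      push_cast at h ⊢
      exact h
    have hn1 : (n : ℂ) + 1 ≠ 0 := by exact_mod_cast n.succ_ne_zero
    have hn2 : (n : ℂ) ≠ 0 := by exact_mod_cast hn0.ne'
    have hf : ((n - 1).factorial : ℂ) ≠ 0 := by exact_mod_cast (n - 1).factorial_ne_zero
    have hP : ((∏ i, (m i + 1) : ℕ) : ℂ) ≠ 0 := by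
      exact_mod_cast Finset.prod_ne_zero_iff.2 fun i _ => (m i).succ_ne_zero
    -- The factor `n` in `n * F(ν)` turns the `(n - 1)!` in `C` into the `n!` of the formula.
    rw [prod_image_zeroMult, ← mul_numFactorizations hn0, hzeta, ← Nat.mul_factorial_pred hn0.ne',
      hC]
    generalize (∑' h : ℕ, 1 / (h : ℝ) ^ (n + 1) : ℝ) = z
    generalize (∏ i, (m i + 1) : ℕ) = P at hP ⊢
    push_cast
    field_simp
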